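/- **Machines.** A PPT interactive Turing machine (ITM) $M$ gets a security parameter $1^k$ (possibly also a private input), tosses polynomially many (in $k$) uniform coins, and in each activation (by an incoming message, or by the start of the interaction) halts within polynomially many (in $k$) steps with an outgoing message, which is a bit string or "abort" $\bot$. **Commitments.** A non-interactive bit-commitment scheme consists of a PPT sender, which for $1^k$, a bit $b$ and coins $s$ produces a commitment $\mathsf{com}^{(k)}(b;s)$ and a decommitment $\mathsf{decom}^{(k)}(b;s)$, and a deterministic polynomial-time verifier $V^{(k)}(c,d)\in\{0,1,\bot\}$ with $V^{(k)}(\mathsf{com}^{(k)}(b;s),\mathsf{decom}^{(k)}(b;s))=b$ always. Assume it is *computationally hiding*: for every PPT ITM $D$ and every positive polynomial $q$, for all large $k$, $|\Pr[D(1^k,\mathsf{com}^{(k)}(0))=1]-\Pr[D(1^k,\mathsf{com}^{(k)}(1))=1]|<1/q(k)$; and *perfectly binding*: for all sufficiently large $k$ there are no $c,d,d'$ with $V^{(k)}(c,d)=0$ and $V^{(k)}(c,d')=1$. Let $p$ be a polynomial such that all $\mathsf{com}^{(k)}(b;s)$ and $\mathsf{decom}^{(k)}(b;s)$ have length at most $p(k)$.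 **Coin-flipping game $\Gamma^{(k)}$.** Round 1: player 1 sends a string $c$ with $|c|\le p(k)$. Round 2: player 2 sends a bit $r_2$. Round 3: player 1 sends $d$ with $|d|\le p(k)$ and $V^{(k)}(c,d)=1-r_2$ (payoffs $(1,0)$). In every round the player to move may abort instead, which ends the game with payoff $0$ for that player and $1$ for the other one; illegal messages count as abort. **Honest machines.** $M_1$ chooses a random bit $r_1$, sends a random commitment $c=\mathsf{com}^{(k)}(r_1)$, and after receiving $r_2$ sends the corresponding decommitment if $r_1\ne r_2$ and aborts otherwise. $M_2$ answers $c$ with a uniformly random bit $r_2$. **Solution concept.** A *behavioral reduced strategy* of a player assigns a distribution over the legal actions to exactly those of his histories that are consistent with positive-probability actions of the strategy at his earlier histories. The *strategic representation* of a machine $M(1^k)$ is the behavioral reduced strategy given by the distribution of its action at each history it can reach, conditioned on its earlier messages being those in the history. A game is *$(T_1,T_2)$-constrained* if player $i$ may only use strategies in $T_i$; write $T=T_1\times T_2$. In the constrained game, $\sigma\in T$ is an *$\varepsilon$-Nash equilibrium* if no player gains more than $\varepsilon$ in expected payoff by a unilateral deviation within his $T_i$. Let $\sigma(R)$ be the round-$R$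 part of $\sigma$. The player $i$ who moves in round $R$ *faces an $\varepsilon$-threat at $R$ w.r.t. $\sigma$* if there is a round-$R$ strategy $\tau$ of player $i$ consistent with $\sigma_i$ such that some $\pi\in T$ has $\pi(S)=\sigma(S)$ for $S<R$ and $\pi_i(R)=\tau$, and such that for all such $\pi$, and all $\pi'\in T$ with $\pi'(S)=\sigma(S)$ for $S\le R$, for which no player faces an $\varepsilon$-threat at any round $S>R$ w.r.t. $\pi$ or w.r.t. $\pi'$, we have $\mathbb E[u_i(\pi)]>\mathbb E[u_i(\pi')]+\varepsilon$ (a backward recursion on $R$). An *$\varepsilon$-TFNE* is an $\varepsilon$-Nash equilibrium w.r.t. which no $\varepsilon$-threat is faced at any round. A *strategy-filter* $F_i$ maps $(k,M,\varepsilon)$, $\varepsilon\in[0,1]$, either to $\bot$ or to the strategic representation of $M(1^k)$ as player $i$ in $\Gamma^{(k)}$. It is *PPT-covering* if for every PPT ITM $M$ and positive polynomial $q$, $F_i^{(k)}(M,1/q(k))\ne\bot$ for all large $k$. A pair of PPT machines $(M_1,M_2)$ is a *computational threat-free Nash equilibrium (CTFNE)*, *witnessed* by $(F_1,F_2)$,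 if $F_1,F_2$ are PPT-covering and, for all $k$ and all $\varepsilon\in[0,1]$ with $F_i^{(k)}(M_i,\varepsilon)\neq\bot$ for $i=1,2$, the profile $(F_1^{(k)}(M_1,\varepsilon),F_2^{(k)}(M_2,\varepsilon))$ is an $\varepsilon$-TFNE of $\Gamma^{(k)}$ constrained to $T_i=\{F_i^{(k)}(M,\varepsilon): M\text{ PPT ITM},\ F_i^{(k)}(M,\varepsilon)\ne\bot\}$. **Theorem.** There is a pair $(M_1,M_2)$ of honest PPT machines, and every such pair is a CTFNE of $\{\Gamma^{(k)}\}_k$. If moreover the binding condition holds for every $k$, then this is witnessed by the following filters: $F_1$ never takes the value $\bot$; $F_2^{(k)}(M,\varepsilon)=\bot$ if and only if $\varepsilon=0$ or, given a random commitment $\mathsf{com}^{(k)}(b)$ of a uniformly random bit $b$, $M$ replies $b$ with probability greater than $1/2+\varepsilon$. -/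

import Mathlib

open Filter Topology

noncomputable section

/-! ## Two-person extensive games with alternating moves -/

/-- The two players, `P₁` and `P₂`. -/
inductive Player
  | one
  | two
  deriving DecidableEq

/-- The opponent of a player. -/
def Player.other : Player → Player
  | .one => .two
  | .two => .one

/-- An action (protocol message) is a bit string, or `none`, which stands for "abort" (`⊥`). -/
abbrev GameAction := Option (List Bool)

/-- A history is a finite sequence of actions. -/
abbrev History := List GameAction

/-- A finite-horizon two-person extensive game `Γ = (H, P, A, u)` whose players alternate moves,
with finite action sets, in which "abort" is legal at every non-terminal history.  Round `R`
consists of the moves made at the histories of length `R - 1`. -/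
structure ExtensiveGame where
  /-- the histories -/
  H : Set History
  nil_mem : [] ∈ H
  prefix_mem : ∀ h a, h ++ [a] ∈ H → h ∈ H
  finite_actions : ∀ h, {a | h ++ [a] ∈ H}.Finite
  abort_mem : ∀ h a, h ++ [a] ∈ H → h ++ [none] ∈ H
  /-- the number of rounds -/
  rounds : ℕ
  length_le : ∀ h ∈ H, h.length ≤ rounds
  /-- the player who moves in the first round -/
  first : Player
  /-- the payoffs (only the values at terminal histories matter) -/
  u : Player → History → ℝ

namespace ExtensiveGame

variable (G : ExtensiveGame)

/-- The player who moves after `n` actions have been taken. -/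
def mover (n : ℕ) : Player := if Even n then G.first else G.first.other

/-- `P(h)`: the player whose turn it is at the history `h`. -/
def player (h : History) : Player := G.mover h.length

/-- `A(h)`: the actions that are available at the history `h`. -/
def actions (h : History) : Set GameAction := {a | h ++ [a] ∈ G.H}

/-- `h` is a non-terminal history at which player `i` moves. -/
def IsDecision (i : Player) (h : History) : Prop :=
  h ∈ G.H ∧ (G.actions h).Nonempty ∧ G.player h = i

/-- A behavioral reduced strategy of player `i`: a distribution over `A(h)` for every history `h`
of player `i` which is consistent with the strategy's own behavior at the earlier histories, and
`none` (`⊥`) at all other histories. -/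
structure ReducedStrategy (i : Player) where
  dist : History → Option (PMF GameAction)
  legal : ∀ h μ, dist h = some μ → μ.support ⊆ G.actions h
  dom : ∀ h, (∃ μ, dist h = some μ) ↔
    G.IsDecision i h ∧ ∀ g a, g ++ [a] <+: h → G.player g = i → ∃ μ, dist g = some μ ∧ a ∈ μ.support

/-- A profile of behavioral reduced strategies. -/
abbrev Profile := ∀ i : Player, G.ReducedStrategy i

variable {G}

/-- The distribution over histories that results from playing at most `n` moves from `h`
according to the profile `σ`. -/
def outcomeFrom (σ : G.Profile) : ℕ → History → PMF History
  | 0, h => PMF.pure h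
  | n + 1, h =>
    match (σ (G.player h)).dist h with
    | none => PMF.pure h
    | some μ => μ.bind fun a => outcomeFrom σ n (h ++ [a])

/-- `O(σ)`: the distribution over terminal histories when the profile `σ` is played. -/
def outcome (σ : G.Profile) : PMF History := outcomeFrom σ G.rounds []

/-- `E[u_i(O(σ))]` (the outcome has finite support). -/
def payoff (i : Player) (σ : G.Profile) : ℝ := ∑' z, (outcome σ z).toReal * G.u i z

/-- Player `i`'s round `R` reduced strategy implied by `σᵢ`. -/
def ReducedStrategy.round {i : Player} (s : G.ReducedStrategy i) (R : ℕ) :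
    History → Option (PMF GameAction) :=
  fun h => if h.length + 1 = R then s.dist h else none

/-- `σ` and `π` have the same round `S` strategies, `σ(S) = π(S)`. -/
def SameRound (σ π : G.Profile) (S : ℕ) : Prop := ∀ i, (σ i).round S = (π i).round S

/-- `τ` is a round `R` reduced strategy of the player with strategy `s`, consistent with `s`. -/
def IsRoundStrategy {i : Player} (s : G.ReducedStrategy i) (R : ℕ)
    (τ : History → Option (PMF GameAction)) : Prop :=
  ∃ s' : G.ReducedStrategy i, (∀ S < R, s'.round S = s.round S) ∧ s'.round R = τ

variable (G) in
/-- The player who moves in round `R`, for `R ≥ 1`. -/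
def roundPlayer (R : ℕ) : Player := G.mover (R - 1)

/-- The profiles that are allowed by the constraints `T = (T₁, T₂)`. -/
def Allowed (T : ∀ i, Set (G.ReducedStrategy i)) : Set G.Profile := {π | ∀ i, π i ∈ T i}

/-- `Cont(σ(1), …, σ(R))`. -/
def cont (T : ∀ i, Set (G.ReducedStrategy i)) (σ : G.Profile) (R : ℕ) : Set G.Profile :=
  {π | π ∈ Allowed T ∧ ∀ S ≤ R, SameRound π σ S}

/-- `Cont(σ(1), …, σ(R - 1), τ(R))`, for a round `R` strategy `τ` of the player who moves in
round `R`. -/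
def contWith (T : ∀ i, Set (G.ReducedStrategy i)) (σ : G.Profile) (R : ℕ)
    (τ : History → Option (PMF GameAction)) : Set G.Profile :=
  {π | π ∈ Allowed T ∧ (∀ S < R, SameRound π σ S) ∧ (π (G.roundPlayer R)).round R = τ}

/-- In the `T`-constrained game, the player who moves in round `R` is facing an `ε`-threat at
round `R` with respect to `σ`.  The condition "for all rounds `S > R` ..." inside says that the
profile is `ε`-threat-free on `R`. -/
def FacesThreat (T : ∀ i, Set (G.ReducedStrategy i)) (ε : ℝ) (R : ℕ) (σ : G.Profile) : Prop :=
  ∃ τ, IsRoundStrategy (σ (G.roundPlayer R)) R τ ∧ (contWith T σ R τ).Nonempty ∧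
    ∀ π ∈ contWith T σ R τ, ∀ π' ∈ cont T σ R,
      (∀ S, R < S → S ≤ G.rounds → ¬ FacesThreat T ε S π) →
      (∀ S, R < S → S ≤ G.rounds → ¬ FacesThreat T ε S π') →
      payoff (G.roundPlayer R) π > payoff (G.roundPlayer R) π' + ε
termination_by G.rounds - R

/-- `σ` is an `ε`-Nash equilibrium of the `T`-constrained game. -/
def IsNash (T : ∀ i, Set (G.ReducedStrategy i)) (ε : ℝ) (σ : G.Profile) : Prop :=
  σ ∈ Allowed T ∧
    ∀ i, ∀ s ∈ T i, payoff i σ ≥ payoff i (Function.update σ i s) - ε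

/-- `σ` is an `ε`-threat-free Nash equilibrium of the `T`-constrained game. -/
def IsTFNE (T : ∀ i, Set (G.ReducedStrategy i)) (ε : ℝ) (σ : G.Profile) : Prop :=
  IsNash T ε σ ∧ ∀ R, 1 ≤ R → R ≤ G.rounds → ¬ FacesThreat T ε R σ

end ExtensiveGame

/-! ## Probabilistic polynomial-time interactive Turing machines -/

/-- The distinguished tapes of an interactive machine: the security parameter in unary, a private
input, the random coins, the incoming message and the outgoing message. -/
inductive Tape
  | param
  | input
  | coin
  | recv
  | send
  deriving DecidableEq

/-- An interactive Turing machine, as a multi-tape machine in Mathlib's `TM2` model (each tape is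
a stack of bits; a two-way tape is a pair of stacks): besides the five distinguished tapes it has
finitely many work tapes, finitely many labels and a finite set of internal states. -/
structure ITM where
  W : Type
  Label : Type
  State : Type
  [decW : DecidableEq W]
  [finW : Finite W]
  [finLabel : Finite Label]
  [finState : Finite State]
  main : Label
  init : State
  prog : Label → Turing.TM2.Stmt (fun _ : Tape ⊕ W => Bool) Label State

attribute [instance] ITM.decW

/-- How a message is written on a communication tape: the empty tape stands for "no message", a
string is preceded by the bit `true`. -/
def encodeMessage : GameAction → List Bool
  | none => []
  | some m => true :: m

/-- How the contents of the outgoing communication tape are read. -/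
def decodeMessage : List Bool → GameAction
  | true :: m => some m
  | _ => none

namespace ITM

variable (M : ITM)

/-- Configurations of the machine. -/
abbrev Cfg := Turing.TM2.Cfg (fun _ : Tape ⊕ M.W => Bool) M.Label M.State

/-- One step of computation; a machine that has halted stays put. -/
def step (c : M.Cfg) : M.Cfg := (Turing.TM2.step M.prog c).getD c

/-- The initial configuration on security parameter `1^k`, private input `z` and coins `r`. -/
def start (k : ℕ) (z r : List Bool) : M.Cfg where
  l := none
  var := M.init
  stk t := match t with
    | .inl .param => List.replicate k true
    | .inl .input => z
    | .inl .coin => r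
    | _ => []

/-- The machine is activated by an incoming message: the message is put on the incoming tape, the
outgoing tape is emptied, and the program is run for `t` steps from its entry point.  Internal state
and all other tapes are kept from the previous activation. -/
def activate (t : ℕ) (c : M.Cfg) (m : GameAction) : M.Cfg :=
  M.step^[t]
    { l := some M.main
      var := c.var
      stk := Function.update (Function.update c.stk (.inl .recv) (encodeMessage m))
        (.inl .send) [] }

/-- The configuration after having been activated by the messages `ms` one after the other. -/
def after (t k : ℕ) (z r : List Bool) (ms : List GameAction) : M.Cfg :=
  ms.foldl (M.activate t) (M.start k z r)

end ITM

/-- A PPT interactive Turing machine: it tosses `coins(k)` coins, and in every activation it halts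
within `time(k)` steps, whatever its coins, its private input and the messages that it receives
(`coins`, `time` polynomials). -/
structure PPTMachine extends ITM where
  coins : Polynomial ℕ
  time : Polynomial ℕ
  halts : ∀ (k : ℕ) (z : List Bool) (r : Fin (coins.eval k) → Bool) (ms : List GameAction) (m : GameAction),
    (toITM.after (time.eval k) k z (List.ofFn r) (ms ++ [m])).l = none

namespace PPTMachine

variable (M : PPTMachine)

/-- The possible coin vectors on security parameter `k`. -/
abbrev Coins (k : ℕ) : Type := Fin (M.coins.eval k) → Bool

/-- The message sent by the machine, with private input `z` and coins `r`, in reply to the last of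
the messages `ms`. -/
def reply (k : ℕ) (z : List Bool) (r : M.Coins k) (ms : List GameAction) : GameAction :=
  decodeMessage ((M.after (M.time.eval k) k z (List.ofFn r) ms).stk (.inl .send))

/-- The uniform distribution on coin vectors. -/
def coinDist (k : ℕ) : PMF (M.Coins k) := PMF.uniformOfFintype _

end PPTMachine

/-! ## The strategic representation of a machine -/

namespace ExtensiveGame

variable (G : ExtensiveGame)

/-- The messages that player `i` has received at the history `h`.  If `i` moves first, its machine
is first activated without a message. -/
def received (i : Player) (h : History) : List GameAction :=
  (if G.first = i then [none] else []) ++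
    h.zipIdx.filterMap fun x => if G.mover x.2 = i then none else some x.1

open Classical in
/-- The action of player `i` at `h`, if it uses the machine `M` with coins `r`: the message sent
by `M`, where an illegal message counts as abort. -/
def machineAction (i : Player) (M : PPTMachine) (k : ℕ) (r : M.Coins k) (h : History) : GameAction :=
  if M.reply k [] r (G.received i h) ∈ G.actions h then M.reply k [] r (G.received i h) else none

/-- With coins `r`, the machine `M` of player `i` sends all messages that `h` ascribes to `i`. -/
def Consistent (i : Player) (M : PPTMachine) (k : ℕ) (r : M.Coins k) (h : History) : Prop :=
  ∀ g a, g ++ [a] <+: h → G.player g = i → G.machineAction i M k r g = a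

variable {G} in
theorem Consistent.mono {i : Player} {M : PPTMachine} {k : ℕ} {r : M.Coins k} {g h : History}
    (hh : G.Consistent i M k r h) (hg : g <+: h) : G.Consistent i M k r g :=
  fun f a hf hi => hh f a (hf.trans hg) hi

open Classical in
/-- The coins with which `M` reaches the history `h`. -/
def consistentCoins (i : Player) (M : PPTMachine) (k : ℕ) (h : History) : Finset (M.Coins k) :=
  Finset.univ.filter fun r => G.Consistent i M k r h

open Classical in
/-- At a history `h` of player `i` that `M` reaches with positive probability: the distribution of
the action of `M` at `h` conditioned on its earlier messages being those in `h`. -/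
def repDist (i : Player) (M : PPTMachine) (k : ℕ) (h : History) : Option (PMF GameAction) :=
  if hh : G.IsDecision i h ∧ (G.consistentCoins i M k h).Nonempty then
    some ((PMF.uniformOfFinset _ hh.2).map fun r => G.machineAction i M k r h)
  else none

theorem mem_support_of_repDist {i : Player} {M : PPTMachine} {k : ℕ} {h : History}
    {μ : PMF GameAction} (hμ : G.repDist i M k h = some μ) (a : GameAction) :
    a ∈ μ.support ↔ ∃ r, G.Consistent i M k r h ∧ G.machineAction i M k r h = a := by
  unfold repDist at hμ
  split_ifs at hμ with hh
  cases hμ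
  rw [PMF.mem_support_map_iff]
  simp [consistentCoins]

theorem exists_repDist_iff {i : Player} {M : PPTMachine} {k : ℕ} {h : History} :
    (∃ μ, G.repDist i M k h = some μ) ↔ G.IsDecision i h ∧ ∃ r, G.Consistent i M k r h := by
  unfold repDist
  split_ifs with hh
  · simp only [Option.some.injEq, exists_eq', true_iff]
    obtain ⟨r, hr⟩ := hh.2
    exact ⟨hh.1, r, by simpa [consistentCoins] using hr⟩
  · simp only [exists_false, false_iff]
    rintro ⟨h1, r, hr⟩
    exact hh ⟨h1, r, by simpa [consistentCoins] using hr⟩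

theorem exists_consistent (i : Player) (M : PPTMachine) (k : ℕ) (h : History)
    (hh : ∀ g a, g ++ [a] <+: h → G.player g = i →
      ∃ μ, G.repDist i M k g = some μ ∧ a ∈ μ.support) :
    ∃ r, G.Consistent i M k r h := by
  induction h using List.reverseRecOn with
  | nil =>
    refine ⟨fun _ => false, fun g a hg => ?_⟩
    simp at hg
  | append_singleton h b ih =>
    by_cases hp : G.player h = i
    · obtain ⟨μ, hμ, hb⟩ := hh h b (List.prefix_refl _) hp
      obtain ⟨r, hr, hrb⟩ := (G.mem_support_of_repDist hμ b).1 hb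
      refine ⟨r, fun g a hg hi => ?_⟩
      rcases List.prefix_concat_iff.1 hg with he | hg'
      · obtain ⟨rfl, hab⟩ := List.append_inj' he rfl
        simp only [List.cons.injEq, and_true] at hab
        rw [hab]
        exact hrb
      · exact hr g a hg' hi
    · obtain ⟨r, hr⟩ := ih fun g a hg hi => hh g a (hg.trans (List.prefix_append _ _)) hi
      refine ⟨r, fun g a hg hi => ?_⟩
      rcases List.prefix_concat_iff.1 hg with he | hg'
      · obtain ⟨rfl, -⟩ := List.append_inj' he rfl
        exact absurd hi hp
      · exact hr g a hg' hi

/-- The strategic representation of the machine `M(1^k)` used by player `i`: the behavioral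
reduced strategy of its conditional action distributions. -/
def strategicRep (i : Player) (M : PPTMachine) (k : ℕ) : G.ReducedStrategy i where
  dist := G.repDist i M k
  legal := by
    intro h μ hμ a ha
    obtain ⟨r, -, rfl⟩ := (G.mem_support_of_repDist hμ a).1 ha
    obtain ⟨⟨-, ⟨b, hb⟩, -⟩, -⟩ := G.exists_repDist_iff.1 ⟨μ, hμ⟩
    unfold machineAction
    split_ifs with hr
    · exact hr
    · exact G.abort_mem h b hb
  dom := by
    intro h
    rw [exists_repDist_iff]
    refine and_congr_right fun hd => ⟨?_, G.exists_consistent i M k h⟩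
    rintro ⟨r, hr⟩ g a hg hi
    have hmem : ∀ l : List GameAction, h = (g ++ [a]) ++ l → g ++ [a] ∈ G.H := by
      intro l
      have hH := hd.1
      intro hl
      rw [hl] at hH
      clear hl hg
      induction l using List.reverseRecOn with
      | nil => simpa using hH
      | append_singleton l b ih =>
        rw [← List.append_assoc] at hH
        exact ih (G.prefix_mem _ _ hH)
    obtain ⟨l, hl⟩ := hg
    have hga := hmem l hl.symm
    have hpre : g <+: h := (List.prefix_append g [a]).trans ⟨l, hl⟩
    obtain ⟨μ, hμ⟩ := (G.exists_repDist_iff (i := i) (M := M) (k := k) (h := g)).2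
      ⟨⟨G.prefix_mem _ _ hga, ⟨a, hga⟩, hi⟩, r, hr.mono hpre⟩
    exact ⟨μ, hμ, (G.mem_support_of_repDist hμ a).2 ⟨r, hr.mono hpre, hr g a ⟨l, hl⟩ hi⟩⟩

end ExtensiveGame

/-! ## Strategy-filters and computational threat-free Nash equilibria -/

/-- A computational game: one extensive game for every value of the security parameter. -/
abbrev ComputationalGame := ℕ → ExtensiveGame

/-- A strategy-filter for player `i`: it maps a machine, for given `k` and `ε ∈ [0, 1]`, to its
strategic representation in `Γ^(k)`, or to `none` (`⊥`). -/
structure StrategyFilter (Γ : ComputationalGame) (i : Player) where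
  toFun : ∀ k : ℕ, PPTMachine → unitInterval → Option ((Γ k).ReducedStrategy i)
  spec : ∀ k M ε, toFun k M ε = none ∨ toFun k M ε = some ((Γ k).strategicRep i M k)

namespace StrategyFilter

variable {Γ : ComputationalGame} {i : Player}

/-- The filter eventually accepts every PPT machine at level `1 / p(k)`, for every positive
polynomial `p`. -/
def PPTCovering (F : StrategyFilter Γ i) : Prop :=
  ∀ (M : PPTMachine) (p : Polynomial ℝ), (∀ n : ℕ, 0 < p.eval (n : ℝ)) →
    ∃ k₀ : ℕ, ∀ k ≥ k₀, ∀ ε : unitInterval, (ε : ℝ) = 1 / p.eval (k : ℝ) → F.toFun k M ε ≠ none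

/-- The `(k, ε)`-tractable reduced strategies. -/
def tractable (F : StrategyFilter Γ i) (k : ℕ) (ε : unitInterval) :
    Set ((Γ k).ReducedStrategy i) :=
  {s | ∃ M, F.toFun k M ε = some s}

open Classical in
/-- The filter that accepts `M` at `(k, ε)` if and only if `acc k M ε` holds. -/
def ofPred (Γ : ComputationalGame) (i : Player) (acc : ℕ → PPTMachine → unitInterval → Prop) :
    StrategyFilter Γ i where
  toFun k M ε := if acc k M ε then some ((Γ k).strategicRep i M k) else none
  spec k M ε := by
    by_cases h : acc k M ε <;> simp [h]

end StrategyFilter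

/-- The filters `F = (F₁, F₂)` witness that the pair of machines `M = (M₁, M₂)` is a CTFNE. -/
def WitnessCTFNE (Γ : ComputationalGame) (M : Player → PPTMachine)
    (F : ∀ i, StrategyFilter Γ i) : Prop :=
  (∀ i, (F i).PPTCovering) ∧
    ∀ (k : ℕ) (ε : unitInterval) (σ : (Γ k).Profile), (∀ i, (F i).toFun k (M i) ε = some (σ i)) →
      ExtensiveGame.IsTFNE (fun i => (F i).tractable k ε) (ε : ℝ) σ

/-- The pair of PPT machines `M = (M₁, M₂)` is in a computational threat-free Nash equilibrium. -/
def IsCTFNE (Γ : ComputationalGame) (M : Player → PPTMachine) : Prop :=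
  ∃ F : ∀ i, StrategyFilter Γ i, WitnessCTFNE Γ M F

/-! ## Commitment schemes -/

/-- The output of a verifier, read off its last message: a bit, or `none` (`⊥`). -/
def asBit : GameAction → Option Bool
  | some [b] => some b
  | _ => none

/-- A non-interactive bit-commitment scheme with perfect completeness.  The sender has the
committed bit as private input; its first message is the commitment, its second output is the
decommitment.  The verifier is deterministic; it is given the commitment and then the
decommitment. -/
structure CommitmentScheme where
  sender : PPTMachine
  verifier : PPTMachine
  verifier_det : verifier.coins = 0
  complete : ∀ (k : ℕ) (b : Bool) (s : sender.Coins k) (v : verifier.Coins k), ∃ c d : List Bool,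
    sender.reply k [b] s [none] = some c ∧ sender.reply k [b] s [none, none] = some d ∧
      asBit (verifier.reply k [] v [some c, some d]) = some b

namespace CommitmentScheme

variable (C : CommitmentScheme)

/-- The commitment to `b` with coins `s`. -/
def com (k : ℕ) (b : Bool) (s : C.sender.Coins k) : List Bool :=
  (C.sender.reply k [b] s [none]).getD []

/-- The decommitment that belongs to the commitment to `b` with coins `s`. -/
def decom (k : ℕ) (b : Bool) (s : C.sender.Coins k) : List Bool :=
  (C.sender.reply k [b] s [none, none]).getD []

/-- The value that the decommitment `d` to `c` reveals, if `d` is legal (the verifier has no coins,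
so its coin vector is irrelevant). -/
def verify (k : ℕ) (c d : List Bool) : Option Bool :=
  asBit (C.verifier.reply k [] (fun _ => false) [some c, some d])

/-- Perfect binding for the security parameter `k`: no string can be opened in two ways. -/
def BindingAt (k : ℕ) : Prop :=
  ∀ c d d', ¬ (C.verify k c d = some false ∧ C.verify k c d' = some true)

/-- The probability that `D`, given a random commitment to `b`, outputs the bit `1`. -/
def acceptProb (D : PPTMachine) (k : ℕ) (b : Bool) : ℝ :=
  (((C.sender.coinDist k).bind fun s => (D.coinDist k).map fun r =>
    asBit (D.reply k [] r [some (C.com k b s)])) (some true)).toReal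

/-- Computational hiding: commitments to `0` and commitments to `1` are computationally
indistinguishable. -/
def ComputationallyHiding : Prop :=
  ∀ (D : PPTMachine) (p : Polynomial ℝ), (∀ n : ℕ, 0 < p.eval (n : ℝ)) →
    ∀ᶠ k : ℕ in atTop, |C.acceptProb D k false - C.acceptProb D k true| < 1 / p.eval (k : ℝ)

/-- The probability that `M`, given a random commitment of a random bit, replies with that bit. -/
def guessProb (M : PPTMachine) (k : ℕ) : ℝ :=
  (((PMF.uniformOfFintype Bool).bind fun b => (C.sender.coinDist k).bind fun s =>
    (M.coinDist k).map fun r =>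
      decide (M.reply k [] r [some (C.com k b s)] = some [b])) true).toReal

end CommitmentScheme

/-! ## The coin-flipping game -/

/-- The histories of the coin-flipping game, with messages of length at most `n` in rounds 1
and 3. -/
inductive CoinHistory (C : CommitmentScheme) (k n : ℕ) : History → Prop
  | nil : CoinHistory C k n []
  | abort₁ : CoinHistory C k n [none]
  | commit (c : List Bool) : c.length ≤ n → CoinHistory C k n [some c]
  | abort₂ (c : List Bool) : c.length ≤ n → CoinHistory C k n [some c, none]
  | guess (c : List Bool) (b : Bool) : c.length ≤ n → CoinHistory C k n [some c, some [b]]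
  | abort₃ (c : List Bool) (b : Bool) : c.length ≤ n → CoinHistory C k n [some c, some [b], none]
  | reveal (c : List Bool) (b : Bool) (d : List Bool) : c.length ≤ n → d.length ≤ n →
      C.verify k c d = some (!b) → CoinHistory C k n [some c, some [b], some d]

/-- Player 1 wins if player 2 aborts or if player 1 reveals a bit different from player 2's. -/
def coinPayoffOne : History → ℝ
  | [some _, none] => 1
  | [some _, some _, some _] => 1
  | _ => 0

/-- The coin-flipping game `Γ^(k)`. -/
def coinFlipGame (C : CommitmentScheme) (p : Polynomial ℕ) : ComputationalGame := fun k =>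
  { H := {h | CoinHistory C k (p.eval k) h}
    nil_mem := .nil
    prefix_mem := by
      intro h a hh
      generalize hg : h ++ [a] = g at hh
      rcases hh with _ | _ | ⟨c, hc⟩ | ⟨c, hc⟩ | ⟨c, b, hc⟩ | ⟨c, b, hc⟩ | ⟨c, b, d, hc, hd, hv⟩
      · simp at hg
      · obtain ⟨rfl, -⟩ := List.append_inj' (t₁ := [none]) (s₁ := []) hg.symm rfl
        exact .nil
      · obtain ⟨rfl, -⟩ := List.append_inj' (t₁ := [some c]) (s₁ := []) hg.symm rfl
        exact .nil
      · obtain ⟨rfl, -⟩ := List.append_inj' (t₁ := [none]) (s₁ := [some c]) hg.symm rfl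
        exact .commit c hc
      · obtain ⟨rfl, -⟩ := List.append_inj' (t₁ := [some [b]]) (s₁ := [some c]) hg.symm rfl
        exact .commit c hc
      · obtain ⟨rfl, -⟩ := List.append_inj' (t₁ := [none]) (s₁ := [some c, some [b]]) hg.symm rfl
        exact .guess c b hc
      · obtain ⟨rfl, -⟩ := List.append_inj' (t₁ := [some d]) (s₁ := [some c, some [b]]) hg.symm rfl
        exact .guess c b hc
    finite_actions := by
      intro h
      have hfin : (insert none (some '' {l : List Bool | l.length ≤ max 1 (p.eval k)})).Finite :=
        ((List.finite_length_le Bool _).image _).insert _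
      refine hfin.subset fun a ha => ?_
      have key : ∀ g, CoinHistory C k (p.eval k) g → ∀ m : List Bool, some m ∈ g →
          m.length ≤ max 1 (p.eval k) := by
        intro g hg m hm
        cases hg <;> simp at hm
        all_goals
          try rcases hm with rfl | rfl | rfl
          try rcases hm with rfl | rfl
          try subst hm
          all_goals simp_all
      cases a with
      | none => exact Set.mem_insert _ _
      | some m =>
        exact Set.mem_insert_of_mem _ ⟨m, key _ ha m (by simp), rfl⟩
    abort_mem := by
      intro h a hh
      generalize hg : h ++ [a] = g at hh
      rcases hh with _ | _ | ⟨c, hc⟩ | ⟨c, hc⟩ | ⟨c, b, hc⟩ | ⟨c, b, hc⟩ | ⟨c, b, d, hc, hd, hv⟩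
      · simp at hg
      · obtain ⟨rfl, -⟩ := List.append_inj' (t₁ := [none]) (s₁ := []) hg.symm rfl
        exact .abort₁
      · obtain ⟨rfl, -⟩ := List.append_inj' (t₁ := [some c]) (s₁ := []) hg.symm rfl
        exact .abort₁
      · obtain ⟨rfl, -⟩ := List.append_inj' (t₁ := [none]) (s₁ := [some c]) hg.symm rfl
        exact .abort₂ c hc
      · obtain ⟨rfl, -⟩ := List.append_inj' (t₁ := [some [b]]) (s₁ := [some c]) hg.symm rfl
        exact .abort₂ c hc
      · obtain ⟨rfl, -⟩ := List.append_inj' (t₁ := [none]) (s₁ := [some c, some [b]]) hg.symm rfl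
        exact .abort₃ c b hc
      · obtain ⟨rfl, -⟩ := List.append_inj' (t₁ := [some d]) (s₁ := [some c, some [b]]) hg.symm rfl
        exact .abort₃ c b hc
    rounds := 3
    length_le := by
      intro h hh
      cases hh <;> simp
    first := .one
    u := fun i h => match i with
      | .one => coinPayoffOne h
      | .two => 1 - coinPayoffOne h }

/-- The machines `M = (M₁, M₂)` carry out the prescribed protocol.
`M₁`: choose a random bit `r₁`, send a random commitment to `r₁`; upon receipt of the bit `r₂`, send
the decommitment if `r₁ ≠ r₂`, and abort otherwise (jointly distributed, as a function of `r₂`).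
`M₂`: upon receipt of a commitment send a uniformly random bit. -/
def IsHonestPair (C : CommitmentScheme) (M : Player → PPTMachine) : Prop :=
  (∀ k : ℕ,
    (((M .one).coinDist k).map fun r =>
      ((M .one).reply k [] r [none], fun r₂ : Bool => (M .one).reply k [] r [none, some [r₂]])) =
    (PMF.uniformOfFintype Bool).bind fun r₁ => (C.sender.coinDist k).map fun s =>
      (some (C.com k r₁ s), fun r₂ : Bool => if r₁ ≠ r₂ then some (C.decom k r₁ s) else none)) ∧
  ∀ (k : ℕ) (c : List Bool),
    (((M .two).coinDist k).map fun r => (M .two).reply k [] r [some c]) =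
      (PMF.uniformOfFintype Bool).map fun r₂ => some [r₂]

/-- The filters of the coin-flipping game: player 1's filter never maps to `⊥`; player 2's filter
maps `M` to `⊥` at `(k, ε)` if and only if `M` guesses the committed bit with advantage greater than
`ε`, or `ε = 0`. -/
def coinFilters (C : CommitmentScheme) (p : Polynomial ℕ) :
    ∀ i, StrategyFilter (coinFlipGame C p) i
  | .one => .ofPred _ .one fun _ _ _ => True
  | .two => .ofPred _ .two fun k M ε => 0 < (ε : ℝ) ∧ C.guessProb M k ≤ 1 / 2 + (ε : ℝ)

end

/-!
# Coin flipping with a perfectly binding commitment is in computational threat-free equilibrium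

*Existence of honest machines.*  The honest machine of player 1 is the sender of the commitment
scheme, run on an additional tape that serves as its private input and receives the first coin;
`Simulates` keeps track of the simulation.  The honest machine of player 2 outputs its only coin.

*Values.*  The payoffs add up to one, so everything is about the probability that player 1 wins.
If player 2 replies with a uniform bit, player 1 wins with probability at most `1 / 2`, because a
commitment can be opened to one bit only (`CoinFlip.winProb_le_half`).  The honest machine of
player 1 opens whenever this is possible at all (`CoinFlip.opens_of_isHonestPair`), hence its third
round is optimal whatever player 2 does (`CoinFlip.Opens.winProb_le`); and against it a
machine of player 2 wins only if it guesses the committed bit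
(`CoinFlip.one_sub_guessProb_le_payoff`), that is, with probability at most `1 / 2 + ε` if it has
passed the filter.  This gives the `ε`-Nash property.

*Threats.*  There is none in round 3, by optimality of opening.  In round 2 a deviation of
player 2, continued by honest opening, is free of threats in round 3 and gains at most `ε`.  In
round 1, let player 1 deviate to `τ`.  For every strategy `s₂` of player 2 let `b s₂` be a
continuation of `τ` that is optimal up to `ε` against `s₂`, and let `s₂` minimize the value of
`(b s₂, s₂)` up to `ε`.  Then `(b s₂, s₂)` is free of threats in rounds 2 and 3, and its value for
player 1 exceeds that of `b σ₂` against the uniform reply `σ₂` by at most `ε`, hence is at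
most `1 / 2 + ε` (`CoinFlip.not_facesThreat_one`).  No machine has to be constructed here: almost
optimal elements exist in any nonempty set of strategies.

*Covering.*  A machine that guesses the committed bit distinguishes commitments to `0` from
commitments to `1`, so by hiding every machine eventually passes the filter of player 2
(`CommitmentScheme.ComputationallyHiding.eventually_guessProb_le`).  If binding holds for large
security parameters only, the filter of player 1 rejects all machines for the others.
-/

/-! ### Simulating a machine inside a larger one -/

open Turing in
/-- The program text `q`, transported to a machine with more tapes, more labels and a larger
internal state: tapes are renamed along `e`, labels along `lab`, and the second component of the
internal state is left alone. -/
def embedStmt {K K' Λ Λ' σ X : Type} (e : K → K') (lab : Λ → Λ') :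
    TM2.Stmt (fun _ : K => Bool) Λ σ → TM2.Stmt (fun _ : K' => Bool) Λ' (σ × X)
  | .push t f q => .push (e t) (fun v => f v.1) (embedStmt e lab q)
  | .peek t f q => .peek (e t) (fun v a => (f v.1 a, v.2)) (embedStmt e lab q)
  | .pop t f q => .pop (e t) (fun v a => (f v.1 a, v.2)) (embedStmt e lab q)
  | .load f q => .load (fun v => (f v.1, v.2)) (embedStmt e lab q)
  | .branch f q₁ q₂ => .branch (fun v => f v.1) (embedStmt e lab q₁) (embedStmt e lab q₂)
  | .goto f => .goto fun v => lab (f v.1)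
  | .halt => .halt

open Turing in
/-- The configuration `c'` of a larger machine simulates the configuration `c`: the labels, the
first component of the internal state and the tapes in the range of `e` are those of `c`, and the
second component of the internal state is `x`. -/
structure Simulates {K K' Λ Λ' σ X : Type} (e : K → K') (lab : Λ → Λ') (x : X)
    (c : TM2.Cfg (fun _ : K => Bool) Λ σ) (c' : TM2.Cfg (fun _ : K' => Bool) Λ' (σ × X)) :
    Prop where
  label : c'.l = c.l.map lab
  var : c'.var = (c.var, x)
  stk : c'.stk ∘ e = c.stk

open Turing in
/-- Executing transported program text preserves the simulation; the tapes outside the range of `e`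
are not touched. -/
theorem simulates_stepAux {K K' Λ Λ' σ X : Type} [DecidableEq K] [DecidableEq K'] {e : K → K'}
    (he : Function.Injective e) (lab : Λ → Λ') (x : X) (q : TM2.Stmt (fun _ : K => Bool) Λ σ)
    (v : σ) (S : K → List Bool) (S' : K' → List Bool) (hS : S' ∘ e = S) :
    Simulates e lab x (TM2.stepAux q v S) (TM2.stepAux (embedStmt e lab q) (v, x) S') := by
  have hSt : ∀ t, S' (e t) = S t := fun t => congrFun hS t
  have upd : ∀ t l, Function.update S' (e t) l ∘ e = Function.update S t l := by
    intro t l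
    rw [← hS]
    exact Function.update_comp_eq_of_injective S' he t l
  induction q generalizing v S S' with
  | push t f q ih =>
    simp only [embedStmt, TM2.stepAux, hSt]
    exact ih _ _ _ (upd _ _) (fun u => congrFun (upd _ _) u) fun u l => by
      rw [← upd t, ← Function.update_comp_eq_of_injective _ he]
  | peek t f q ih =>
    simp only [embedStmt, TM2.stepAux, hSt]
    exact ih _ _ _ hS hSt upd
  | pop t f q ih =>
    simp only [embedStmt, TM2.stepAux, hSt]
    exact ih _ _ _ (upd _ _) (fun u => congrFun (upd _ _) u) fun u l => by
      rw [← upd t, ← Function.update_comp_eq_of_injective _ he]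
  | load f q ih =>
    simp only [embedStmt, TM2.stepAux]
    exact ih _ _ _ hS hSt upd
  | branch f q₁ q₂ ih₁ ih₂ =>
    simp only [embedStmt, TM2.stepAux]
    cases f v
    · exact ih₂ _ _ _ hS hSt upd
    · exact ih₁ _ _ _ hS hSt upd
  | goto f => exact ⟨rfl, rfl, hS⟩
  | halt => exact ⟨rfl, rfl, hS⟩

namespace ITM

theorem step_of_halted (M : ITM) {c : M.Cfg} (hc : c.l = none) : M.step c = c := by
  obtain ⟨l, v, S⟩ := c
  subst hc
  rfl

theorem step_iterate_of_halted (M : ITM) {c : M.Cfg} (hc : c.l = none) (t : ℕ) :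
    M.step^[t] c = c :=
  Function.iterate_fixed (M.step_of_halted hc) t

theorem after_append_singleton (M : ITM) (t k : ℕ) (z r : List Bool) (ms : List GameAction)
    (m : GameAction) :
    M.after t k z r (ms ++ [m]) = M.activate t (M.after t k z r ms) m := by
  simp [after]

end ITM

/-! ### The honest machine of player 1 -/

namespace CommitmentScheme

variable (C : CommitmentScheme)

/-- The tapes of the sender, as tapes of the honest machine of player 1: the private input of the
sender becomes an additional work tape, the others are kept. -/
def embedTape : Tape ⊕ C.sender.W → Tape ⊕ Option C.sender.W
  | .inl .input => .inr none
  | .inl .param => .inl .param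
  | .inl .coin => .inl .coin
  | .inl .recv => .inl .recv
  | .inl .send => .inl .send
  | .inr w => .inr (some w)

theorem embedTape_injective : Function.Injective C.embedTape := by
  rintro ((_ | _ | _ | _ | _) | _) ((_ | _ | _ | _ | _) | _) h <;> simp_all [embedTape]

/-- The entry point of the honest machine of player 1.  The control state is `none` before the
first activation, `some (some b)` between a commitment to `b` and the answer, and `some none`
when nothing is left to be done.  At the first activation the first coin is made the private input
of the sender, which is then run.  At the second activation the sender is run (on the
empty message) if the answer consists of the bit `!b`; in all other cases nothing is sent. -/
def committerEntry : Turing.TM2.Stmt (fun _ : Tape ⊕ Option C.sender.W => Bool)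
    (Option C.sender.Label) (C.sender.State × Option (Option Bool)) :=
  .branch (fun v => v.2.isNone)
    (.pop (.inl .coin) (fun v a => (v.1, some (some (a.getD false))))
      (.push (.inr none) (fun v => (v.2.getD none).getD false)
        (.goto fun _ => some C.sender.main)))
    (.pop (.inl .recv) (fun v a => (v.1, if a = some true then v.2 else some none))
      (.pop (.inl .recv) (fun v a => (v.1, if a = (v.2.getD none).map not then v.2 else some none))
        (.peek (.inl .recv) (fun v a => (v.1, if a = none then v.2 else some none))
          (.branch (fun v => v.2 = some none) .halt
            (.load (fun v => (v.1, some none)) (.goto fun _ => some C.sender.main))))))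

/-- The honest machine of player 1, as an interactive Turing machine. -/
def committerITM : ITM where
  W := Option C.sender.W
  Label := Option C.sender.Label
  State := C.sender.State × Option (Option Bool)
  finW := have := C.sender.finW; inferInstance
  finLabel := have := C.sender.finLabel; inferInstance
  finState := have := C.sender.finState; inferInstance
  main := none
  init := (C.sender.init, none)
  prog
    | none => C.committerEntry
    | some l => embedStmt C.embedTape some (C.sender.prog l)

/-- The configuration `c'` of the honest machine of player 1 simulates the configuration `c` of the
sender, with control state `x`. -/
abbrev CommitterSimulates (x : Option (Option Bool)) (c : C.sender.Cfg) (c' : C.committerITM.Cfg) :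
    Prop :=
  Simulates C.embedTape some x c c'

variable {C}

theorem CommitterSimulates.step {x : Option (Option Bool)} {c : C.sender.Cfg}
    {c' : C.committerITM.Cfg} (h : C.CommitterSimulates x c c') :
    C.CommitterSimulates x (C.sender.step c) (C.committerITM.step c') := by
  obtain ⟨l, v, S⟩ := c
  obtain ⟨l', v', S'⟩ := c'
  obtain ⟨hl, hv, hS⟩ := h
  dsimp only at hl hv hS
  subst hl hv
  cases l with
  | none => exact ⟨rfl, rfl, hS⟩
  | some l => exact simulates_stepAux C.embedTape_injective some x _ _ _ _ hS

theorem CommitterSimulates.iterate {x : Option (Option Bool)} {c : C.sender.Cfg}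
    {c' : C.committerITM.Cfg} (h : C.CommitterSimulates x c c') (t : ℕ) :
    C.CommitterSimulates x (C.sender.step^[t] c) (C.committerITM.step^[t] c') := by
  induction t generalizing c c' with
  | zero => exact h
  | succ t ih => exact ih h.step

theorem CommitterSimulates.activate {x : Option (Option Bool)} {c : C.sender.Cfg}
    {c' : C.committerITM.Cfg} {m m' : GameAction} {t : ℕ}
    (h : C.CommitterSimulates x
      { l := some C.sender.main
        var := c.var
        stk := Function.update (Function.update c.stk (.inl .recv) (encodeMessage m))
          (.inl .send) [] }
      (C.committerITM.step
        { l := some none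
          var := c'.var
          stk := Function.update (Function.update c'.stk (.inl .recv) (encodeMessage m'))
            (.inl .send) [] })) :
    C.CommitterSimulates x (C.sender.activate t c m) (C.committerITM.activate (t + 1) c' m') :=
  h.iterate t

variable (C)

theorem committer_step_entry (v : C.sender.State × Option (Option Bool))
    (S : Tape ⊕ Option C.sender.W → List Bool) :
    C.committerITM.step { l := some none, var := v, stk := S } =
      Turing.TM2.stepAux C.committerEntry v S :=
  rfl

/-- In its first activation the honest machine of player 1 runs the sender, with the first coin as
private input and the remaining coins as coins. -/
theorem committer_first_activation (t k : ℕ) (z r : List Bool) (b : Bool) (m : GameAction) :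
    C.CommitterSimulates (some (some b)) (C.sender.after t k [b] r [m])
      (C.committerITM.after (t + 1) k z (b :: r) [m]) := by
  refine CommitterSimulates.activate (c := C.sender.start k [b] r)
    (c' := C.committerITM.start k z (b :: r)) ?_
  erw [committer_step_entry]
  refine ⟨rfl, rfl, ?_⟩
  funext u
  rcases u with (_ | _ | _ | _ | _) | w <;> rfl

/-- On the awaited bit the honest machine of player 1 runs the second activation of the sender,
which finds the tape of incoming messages emptied. -/
theorem committer_opening_activation {t : ℕ} {b : Bool} {c : C.sender.Cfg}
    {c' : C.committerITM.Cfg} (h : C.CommitterSimulates (some (some b)) c c') :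
    C.CommitterSimulates (some none) (C.sender.activate t c none)
      (C.committerITM.activate (t + 1) c' (some [!b])) := by
  obtain ⟨l, v, S⟩ := c
  obtain ⟨l', v', S'⟩ := c'
  obtain ⟨hl, hv, hS⟩ := h
  dsimp only at hl hv hS
  subst hl hv hS
  refine CommitterSimulates.activate ?_
  erw [committer_step_entry]
  cases b
  all_goals
    refine ⟨rfl, rfl, ?_⟩
    funext u
    rcases u with (_ | _ | _ | _ | _) | w <;> rfl

/-- A message other than the awaited bit makes the honest machine of player 1 halt at once. -/
theorem stepAux_committerEntry_of_refuse (v : C.sender.State) {x : Option Bool} {m : GameAction}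
    (hm : ∀ b, x = some b → m ≠ some [!b]) {S : Tape ⊕ Option C.sender.W → List Bool}
    (hS : S (.inl .recv) = encodeMessage m) :
    Turing.TM2.stepAux C.committerEntry (v, some x) S =
      { l := none
        var := (v, some none)
        stk := Function.update S (.inl .recv) (encodeMessage m).tail.tail } := by
  rcases x with _ | b
  · simp [committerEntry, hS]
  · rcases m with _ | _ | ⟨a, _ | ⟨a', m⟩⟩
    · simp [committerEntry, encodeMessage, hS]
    · simp [committerEntry, encodeMessage, hS]
    · have : a ≠ !b := fun h => hm b rfl (by rw [h])
      simp [committerEntry, encodeMessage, hS, this]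
    · simp [committerEntry, encodeMessage, hS]

theorem committer_refusing_activation {t : ℕ} {x : Option Bool} {c' : C.committerITM.Cfg}
    (hx : c'.var.2 = some x) {m : GameAction} (hm : ∀ b, x = some b → m ≠ some [!b]) :
    (C.committerITM.activate (t + 1) c' m).l = none ∧
      (C.committerITM.activate (t + 1) c' m).var.2 = some none ∧
      (C.committerITM.activate (t + 1) c' m).stk (.inl .send) = [] := by
  obtain ⟨l', ⟨v, y⟩, S'⟩ := c'
  dsimp only at hx
  subst hx
  unfold ITM.activate
  rw [Function.iterate_succ_apply]
  erw [committer_step_entry, stepAux_committerEntry_of_refuse C v hm rfl,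
    ITM.step_iterate_of_halted _ rfl]
  exact ⟨rfl, rfl, rfl⟩

/-- The honest machine of player 1 halts in every activation, and from the second activation on
its control state is the final one. -/
theorem committer_halted (k : ℕ) (z : List Bool) (b : Bool) (s : C.sender.Coins k)
    (m : GameAction) (ms : List GameAction) :
    (C.committerITM.after (C.sender.time.eval k + 1) k z (b :: List.ofFn s) (m :: ms)).l = none ∧
      ((C.committerITM.after (C.sender.time.eval k + 1) k z (b :: List.ofFn s) (m :: ms)).var.2 =
        some none ∨ ms = []) := by
  induction ms using List.reverseRecOn with
  | nil =>
    refine ⟨?_, .inr rfl⟩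
    rw [(C.committer_first_activation (C.sender.time.eval k) k z (List.ofFn s) b m).label]
    exact congrArg (Option.map some) (C.sender.halts k [b] s [] m)
  | append_singleton ms m' ih =>
    rw [← List.cons_append, ITM.after_append_singleton]
    rcases ih.2 with h | rfl
    · obtain ⟨h₁, h₂, -⟩ := C.committer_refusing_activation (t := C.sender.time.eval k) h
        (m := m') (by simp)
      exact ⟨h₁, .inl h₂⟩
    · have h := C.committer_first_activation (C.sender.time.eval k) k z (List.ofFn s) b m
      by_cases hm : m' = some [!b]
      · subst hm
        have h' := C.committer_opening_activation (t := C.sender.time.eval k) h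
        refine ⟨?_, .inl (by rw [h'.var])⟩
        rw [h'.label, ← ITM.after_append_singleton]
        exact congrArg (Option.map some) (C.sender.halts k [b] s [m] none)
      · obtain ⟨h₁, h₂, -⟩ := C.committer_refusing_activation (t := C.sender.time.eval k)
          (x := some b) (by rw [h.var]) (m := m') (by simpa using hm)
        exact ⟨h₁, .inl h₂⟩

theorem committer_send_first (t k : ℕ) (z r : List Bool) (b : Bool) :
    (C.committerITM.after (t + 1) k z (b :: r) [none]).stk (.inl .send) =
      (C.sender.after t k [b] r [none]).stk (.inl .send) :=
  congrFun (C.committer_first_activation t k z r b none).stk (.inl .send)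

theorem committer_send_second (t k : ℕ) (z r : List Bool) (b b' : Bool) :
    (C.committerITM.after (t + 1) k z (b :: r) [none, some [b']]).stk (.inl .send) =
      if b ≠ b' then (C.sender.after t k [b] r [none, none]).stk (.inl .send) else [] := by
  have h := C.committer_first_activation t k z r b none
  have e : ∀ (M : ITM) z r m, M.after t k z r [none, m] =
      M.activate t (M.after t k z r [none]) m := fun _ _ _ _ => rfl
  have e' : ∀ (M : ITM) z r m, M.after (t + 1) k z r [none, m] =
      M.activate (t + 1) (M.after (t + 1) k z r [none]) m := fun _ _ _ _ => rfl
  rw [e, e']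
  split_ifs with hb
  · obtain rfl : b' = !b := by cases b <;> cases b' <;> simp_all
    exact congrFun (C.committer_opening_activation h).stk (.inl .send)
  · obtain rfl : b = b' := not_not.1 hb
    exact (C.committer_refusing_activation (x := some b) (by rw [h.var]) (by simp)).2.2

theorem eval_coins_add_one (k : ℕ) :
    (C.sender.coins + 1).eval k = C.sender.coins.eval k + 1 := by
  simp

/-- The coins of the honest machine of player 1 are the bit to be committed to, followed by the
coins of the sender. -/
noncomputable def committerCoinEquiv (k : ℕ) :
    (Fin ((C.sender.coins + 1).eval k) → Bool) ≃ Bool × C.sender.Coins k :=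
  ((finCongr (C.eval_coins_add_one k)).arrowCongr (.refl Bool)).trans
    (Fin.consEquiv fun _ => Bool).symm

theorem ofFn_committerCoins (k : ℕ) (r : Fin ((C.sender.coins + 1).eval k) → Bool) :
    List.ofFn r = (C.committerCoinEquiv k r).1 :: List.ofFn (C.committerCoinEquiv k r).2 := by
  have e := List.ofFn_congr (C.eval_coins_add_one k) r
  rw [e, List.ofFn_succ]
  rfl

/-- The honest machine of player 1. -/
noncomputable def committer : PPTMachine where
  toITM := C.committerITM
  coins := C.sender.coins + 1
  time := C.sender.time + 1
  halts k z r ms m := by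
    have ht : (C.sender.time + 1).eval k = C.sender.time.eval k + 1 := by simp
    rw [ht, ofFn_committerCoins]
    cases ms with
    | nil => exact (C.committer_halted k z _ _ m []).1
    | cons m' ms => exact (C.committer_halted k z _ _ m' (ms ++ [m])).1

theorem time_committer (k : ℕ) :
    C.committer.time.eval k = C.sender.time.eval k + 1 := by
  simp [committer]

theorem committer_reply_first (k : ℕ) (r : C.committer.Coins k) :
    C.committer.reply k [] r [none] =
      some (C.com k (C.committerCoinEquiv k r).1 (C.committerCoinEquiv k r).2) := by
  obtain ⟨c, d, hc, -, -⟩ := C.complete k (C.committerCoinEquiv k r).1 (C.committerCoinEquiv k r).2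
    fun _ => false
  rw [com, hc, Option.getD_some, ← hc, PPTMachine.reply, PPTMachine.reply, time_committer,
    show List.ofFn r = _ from C.ofFn_committerCoins k r]
  exact congrArg _ (C.committer_send_first _ k [] _ _)

theorem committer_reply_second (k : ℕ) (r : C.committer.Coins k) (b : Bool) :
    C.committer.reply k [] r [none, some [b]] =
      if (C.committerCoinEquiv k r).1 ≠ b then
        some (C.decom k (C.committerCoinEquiv k r).1 (C.committerCoinEquiv k r).2) else none := by
  obtain ⟨c, d, -, hd, -⟩ := C.complete k (C.committerCoinEquiv k r).1 (C.committerCoinEquiv k r).2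
    fun _ => false
  rw [decom, hd, Option.getD_some, ← hd, PPTMachine.reply, PPTMachine.reply, time_committer,
    show List.ofFn r = _ from C.ofFn_committerCoins k r]
  refine (congrArg _ (C.committer_send_second _ k [] _ _ b)).trans ?_
  split_ifs <;> rfl

end CommitmentScheme

/-- Two independent uniform samples may be read off one uniform sample from a type in bijection
with the product. -/
theorem map_uniformOfFintype_of_equiv {α β γ δ : Type} [Fintype α] [Fintype β] [Fintype γ]
    [Nonempty α] [Nonempty β] [Nonempty γ] (e : γ ≃ α × β) (f : α → β → δ) :
    ((PMF.uniformOfFintype γ).map fun c => f (e c).1 (e c).2) =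
      (PMF.uniformOfFintype α).bind fun a => (PMF.uniformOfFintype β).map fun b => f a b := by
  have h : (PMF.uniformOfFintype γ).map e =
      (PMF.uniformOfFintype α).bind fun a => (PMF.uniformOfFintype β).map fun b => (a, b) := by
    ext ⟨a, b⟩
    rw [PMF.map_apply, PMF.bind_apply, tsum_eq_single (e.symm (a, b)), tsum_eq_single a,
      PMF.map_apply, tsum_eq_single b]
    · have hc : Fintype.card γ = Fintype.card α * Fintype.card β := by
        rw [Fintype.card_congr e, Fintype.card_prod]
      simp [hc, ENNReal.mul_inv]
    · intro b' hb
      simp [hb.symm]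
    · intro a' ha
      simp [PMF.map_apply, ha.symm]
    · intro c hc
      rw [if_neg]
      rintro h
      exact hc (by rw [h, Equiv.symm_apply_apply])
  have h' := congrArg (PMF.map fun x : α × β => f x.1 x.2) h
  rw [PMF.map_comp, PMF.map_bind] at h'
  simp only [PMF.map_comp] at h'
  exact h'

/-! ### The honest machine of player 2 -/

/-- The honest machine of player 2: it sends its only coin, as a message of length one. -/
def coinTosserITM : ITM where
  W := Empty
  Label := Unit
  State := Option Bool
  main := ()
  init := none
  prog _ := .pop (.inl .coin) (fun _ a => a)
    (.push (.inl .send) (fun v => v.getD false) (.push (.inl .send) (fun _ => true) .halt))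

/-- The honest machine of player 2, with one coin and halting after one step. -/
noncomputable def coinTosser : PPTMachine where
  toITM := coinTosserITM
  coins := 1
  time := 1
  halts k z r ms m := by
    have ht : (1 : Polynomial ℕ).eval k = 0 + 1 := Polynomial.eval_one
    rw [ITM.after_append_singleton]
    generalize coinTosserITM.after _ k z _ ms = c
    rw [ht]
    rfl

theorem eval_coins_coinTosser (k : ℕ) : coinTosser.coins.eval k = 1 :=
  Polynomial.eval_one

/-- The coin vectors of the honest machine of player 2 are bits; the trivial second factor gives
them the form that `map_uniformOfFintype_of_equiv` expects. -/
noncomputable def coinTosserCoinEquiv (k : ℕ) : coinTosser.Coins k ≃ Bool × Unit :=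
  ((finCongr (eval_coins_coinTosser k)).arrowCongr (.refl Bool)).trans
    ((Equiv.funUnique (Fin 1) Bool).trans (Equiv.prodPUnit Bool).symm)

theorem coinTosser_reply (k : ℕ) (r : coinTosser.Coins k) (c : List Bool) :
    coinTosser.reply k [] r [some c] = some [(coinTosserCoinEquiv k r).1] := by
  have ht : coinTosser.time.eval k = 1 := Polynomial.eval_one
  have hr : List.ofFn r = [(coinTosserCoinEquiv k r).1] := by
    rw [List.ofFn_congr (eval_coins_coinTosser k) r]
    rfl
  rw [PPTMachine.reply, ht, hr]
  rfl

theorem exists_isHonestPair (C : CommitmentScheme) :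
    ∃ M : Player → PPTMachine, IsHonestPair C M := by
  refine ⟨fun | .one => C.committer | .two => coinTosser, fun k => ?_, fun k c => ?_⟩
  · dsimp only
    simp only [C.committer_reply_first, C.committer_reply_second]
    exact map_uniformOfFintype_of_equiv (C.committerCoinEquiv k)
      fun r₁ s => (some (C.com k r₁ s),
        fun r₂ : Bool => if r₁ ≠ r₂ then some (C.decom k r₁ s) else none)
  · dsimp only
    simp only [coinTosser_reply]
    exact (map_uniformOfFintype_of_equiv (coinTosserCoinEquiv k) fun r₂ _ => some [r₂]).trans
      (congrArg (PMF.bind _) (funext fun r₂ => PMF.map_const _ _))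

open scoped ENNReal

/-! ### Expectations of extended nonnegative functions -/

namespace PMF

variable {α β : Type*}

/-- The expectation of `f` with respect to `μ`. -/
noncomputable def lexp (μ : PMF α) (f : α → ℝ≥0∞) : ℝ≥0∞ := ∑' a, μ a * f a

theorem lexp_mono {μ : PMF α} {f g : α → ℝ≥0∞} (h : ∀ a ∈ μ.support, f a ≤ g a) :
    μ.lexp f ≤ μ.lexp g := by
  refine ENNReal.tsum_le_tsum fun a => ?_
  by_cases ha : μ a = 0
  · simp [ha]
  · gcongr
    exact h a ((μ.mem_support_iff a).2 ha)

theorem lexp_congr {μ : PMF α} {f g : α → ℝ≥0∞} (h : ∀ a ∈ μ.support, f a = g a) :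
    μ.lexp f = μ.lexp g :=
  (lexp_mono fun a ha => (h a ha).le).antisymm (lexp_mono fun a ha => (h a ha).ge)

theorem lexp_const (μ : PMF α) (x : ℝ≥0∞) : μ.lexp (fun _ => x) = x := by
  rw [lexp, ENNReal.tsum_mul_right, μ.tsum_coe, one_mul]

theorem lexp_add (μ : PMF α) (f g : α → ℝ≥0∞) :
    μ.lexp (fun a => f a + g a) = μ.lexp f + μ.lexp g := by
  simp only [lexp, mul_add, ENNReal.tsum_add]

theorem lexp_pure (a : α) (f : α → ℝ≥0∞) : (PMF.pure a).lexp f = f a := by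
  rw [lexp, tsum_eq_single a]
  · simp
  · intro b hb
    simp [hb]

theorem lexp_bind (μ : PMF α) (ν : α → PMF β) (f : β → ℝ≥0∞) :
    (μ.bind ν).lexp f = μ.lexp fun a => (ν a).lexp f := by
  simp only [lexp, bind_apply, ← ENNReal.tsum_mul_right, ← ENNReal.tsum_mul_left]
  rw [ENNReal.tsum_comm]
  simp only [mul_assoc]

theorem lexp_map (μ : PMF α) (φ : α → β) (f : β → ℝ≥0∞) :
    (μ.map φ).lexp f = μ.lexp (f ∘ φ) := by
  rw [map, lexp_bind]
  simp only [Function.comp_apply, lexp_pure]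
  rfl

theorem lexp_ite_eq [DecidableEq α] (μ : PMF α) (x : α) :
    μ.lexp (fun a => if a = x then 1 else 0) = μ x := by
  rw [lexp, tsum_eq_single x]
  · simp
  · intro b hb
    simp [hb]

theorem lexp_uniform_bool (f : Bool → ℝ≥0∞) :
    (uniformOfFintype Bool).lexp f = 2⁻¹ * f true + 2⁻¹ * f false := by
  simp [lexp, tsum_fintype]

theorem uniformOfFinset_eq_uniformOfFintype [Fintype α] [Nonempty α] {s : Finset α}
    (hs : s.Nonempty) (h : ∀ a, a ∈ s) : uniformOfFinset s hs = uniformOfFintype α := by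
  obtain rfl := Finset.eq_univ_iff_forall.2 h
  rfl

end PMF

/-! ### The coin-flipping game as a function of the strategies -/

namespace CoinFlip

open ExtensiveGame

variable {C : CommitmentScheme} {p : Polynomial ℕ} {k : ℕ}

theorem player_eq (h : History) :
    (coinFlipGame C p k).player h = if Even h.length then .one else .two := rfl

theorem length_le_of_commit {c : List Bool} (h : [some c] ∈ (coinFlipGame C p k).H) :
    c.length ≤ p.eval k := by
  cases h; assumption

theorem actions_abort₁ : (coinFlipGame C p k).actions [none] = ∅ := by
  refine Set.eq_empty_of_forall_notMem fun a h => ?_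
  cases h

theorem actions_abort₂ (c : List Bool) :
    (coinFlipGame C p k).actions [some c, none] = ∅ := by
  refine Set.eq_empty_of_forall_notMem fun a h => ?_
  cases h

theorem eq_of_mem_actions_commit {c : List Bool} {a : GameAction}
    (h : a ∈ (coinFlipGame C p k).actions [some c]) : a = none ∨ ∃ b, a = some [b] := by
  cases h
  · exact .inl rfl
  · exact .inr ⟨_, rfl⟩

theorem eq_of_mem_actions_guess {c : List Bool} {b : Bool} {a : GameAction}
    (h : a ∈ (coinFlipGame C p k).actions [some c, some [b]]) :
    a = none ∨ ∃ d, a = some d ∧ C.verify k c d = some (!b) := by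
  cases h
  · exact .inl rfl
  · exact .inr ⟨_, rfl, by assumption⟩

theorem isDecision_nil : (coinFlipGame C p k).IsDecision .one [] :=
  ⟨.nil, ⟨none, .abort₁⟩, rfl⟩

theorem isDecision_commit {c : List Bool} (hc : c.length ≤ p.eval k) :
    (coinFlipGame C p k).IsDecision .two [some c] :=
  ⟨.commit c hc, ⟨none, .abort₂ c hc⟩, by simp [player_eq]⟩

theorem isDecision_guess {c : List Bool} (hc : c.length ≤ p.eval k) (b : Bool) :
    (coinFlipGame C p k).IsDecision .one [some c, some [b]] :=
  ⟨.guess c b hc, ⟨none, .abort₃ c b hc⟩, by simp [player_eq]⟩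

/-- Player 2 decides only at the histories that consist of one commitment. -/
theorem eq_commit_of_isDecision {h : History} (hh : (coinFlipGame C p k).IsDecision .two h) :
    ∃ c, h = [some c] := by
  obtain ⟨hH, ⟨a, ha⟩, hp⟩ := hh
  cases hH <;> first | exact ⟨_, rfl⟩ | (exfalso; revert hp; simp [player_eq]; done) | cases ha

variable (s₁ : (coinFlipGame C p k).ReducedStrategy .one)
  (s₂ : (coinFlipGame C p k).ReducedStrategy .two)

theorem exists_dist_nil : ∃ μ, s₁.dist [] = some μ :=
  (s₁.dom []).2 ⟨isDecision_nil, fun g a h => by simp at h⟩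

theorem exists_dist_commit {c : List Bool} (hc : c.length ≤ p.eval k) :
    ∃ μ, s₂.dist [some c] = some μ := by
  refine (s₂.dom _).2 ⟨isDecision_commit hc, fun g a h hg => ?_⟩
  have : g.length = 0 := by simpa using h.length_le
  rw [List.length_eq_zero_iff] at this
  subst this
  simp [player_eq] at hg

theorem exists_dist_guess {c : List Bool} (hc : c.length ≤ p.eval k) (b : Bool)
    {μ : PMF GameAction} (hμ : s₁.dist [] = some μ) (hcμ : some c ∈ μ.support) :
    ∃ μ, s₁.dist [some c, some [b]] = some μ := by
  refine (s₁.dom _).2 ⟨isDecision_guess hc b, fun g a h hg => ?_⟩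
  rcases g with _ | ⟨x, _ | ⟨y, g⟩⟩
  · obtain rfl : a = some c := by simpa using h
    exact ⟨μ, hμ, hcμ⟩
  · simp [player_eq] at hg
  · have := h.length_le
    simp at this

/-- The profile in which the players use `s₁` and `s₂`. -/
def pair : (coinFlipGame C p k).Profile
  | .one => s₁
  | .two => s₂

theorem pair_eta (σ : (coinFlipGame C p k).Profile) : pair (σ .one) (σ .two) = σ := by
  funext i
  cases i <;> rfl

/-- The probability that player 1 wins, if at most `n` moves are played from `h` on. -/
noncomputable def winProb (n : ℕ) (h : History) : ℝ≥0∞ :=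
  (outcomeFrom (pair s₁ s₂) n h).lexp fun z => ENNReal.ofReal (coinPayoffOne z)

theorem coinPayoffOne_mem (z : History) : 0 ≤ coinPayoffOne z ∧ coinPayoffOne z ≤ 1 := by
  unfold coinPayoffOne
  split <;> norm_num

theorem winProb_le_one (n : ℕ) (h : History) : winProb s₁ s₂ n h ≤ 1 := by
  refine (PMF.lexp_mono fun z _ => ?_).trans_eq (PMF.lexp_const _ 1)
  exact ENNReal.ofReal_le_one.2 (coinPayoffOne_mem z).2

theorem winProb_ne_top (n : ℕ) (h : History) : winProb s₁ s₂ n h ≠ ⊤ :=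
  ((winProb_le_one s₁ s₂ n h).trans_lt ENNReal.one_lt_top).ne

theorem winProb_zero (h : History) :
    winProb s₁ s₂ 0 h = ENNReal.ofReal (coinPayoffOne h) :=
  PMF.lexp_pure _ _

theorem payoff_one_eq (σ : (coinFlipGame C p k).Profile) :
    payoff .one σ = (winProb (σ .one) (σ .two) 3 []).toReal := by
  rw [winProb, pair_eta, PMF.lexp, ENNReal.tsum_toReal_eq]
  · refine tsum_congr fun z => ?_
    rw [ENNReal.toReal_mul, ENNReal.toReal_ofReal (coinPayoffOne_mem z).1]
    rfl
  · exact fun z => ENNReal.mul_ne_top (PMF.apply_ne_top _ _) ENNReal.ofReal_ne_top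

theorem payoff_two_eq (σ : (coinFlipGame C p k).Profile) :
    payoff .two σ = 1 - payoff .one σ := by
  have hs : Summable fun z => (outcome σ z).toReal :=
    ENNReal.summable_toReal (by rw [PMF.tsum_coe]; exact ENNReal.one_ne_top)
  have hs' : Summable fun z => (outcome σ z).toReal * coinPayoffOne z :=
    hs.of_nonneg_of_le (fun z => mul_nonneg ENNReal.toReal_nonneg (coinPayoffOne_mem z).1)
      fun z => mul_le_of_le_one_right ENNReal.toReal_nonneg (coinPayoffOne_mem z).2
  have h1 : ∑' z, (outcome σ z).toReal = 1 := by
    rw [← ENNReal.tsum_toReal_eq (fun z => PMF.apply_ne_top _ _), PMF.tsum_coe, ENNReal.toReal_one]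
  change ∑' z, (outcome σ z).toReal * (1 - coinPayoffOne z) =
    1 - ∑' z, (outcome σ z).toReal * coinPayoffOne z
  conv_rhs => rw [← h1, ← hs.tsum_sub hs']
  exact tsum_congr fun z => mul_one_sub _ _

section recursion

variable {s₁ s₂} {μ : PMF GameAction}

theorem winProb_of_one {h : History} (n : ℕ) (he : Even h.length) (hμ : s₁.dist h = some μ) :
    winProb s₁ s₂ (n + 1) h = μ.lexp fun a => winProb s₁ s₂ n (h ++ [a]) := by
  have hd : (pair s₁ s₂ ((coinFlipGame C p k).player h)).dist h = some μ := by
    rw [player_eq, if_pos he]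
    exact hμ
  rw [winProb, outcomeFrom, hd]
  exact PMF.lexp_bind _ _ _

theorem winProb_of_two {h : History} (n : ℕ) (he : ¬ Even h.length) (hμ : s₂.dist h = some μ) :
    winProb s₁ s₂ (n + 1) h = μ.lexp fun a => winProb s₁ s₂ n (h ++ [a]) := by
  have hd : (pair s₁ s₂ ((coinFlipGame C p k).player h)).dist h = some μ := by
    rw [player_eq, if_neg he]
    exact hμ
  rw [winProb, outcomeFrom, hd]
  exact PMF.lexp_bind _ _ _

theorem winProb_of_actions_eq_empty {h : History} (n : ℕ)
    (he : (coinFlipGame C p k).actions h = ∅) :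
    winProb s₁ s₂ n h = ENNReal.ofReal (coinPayoffOne h) := by
  cases n with
  | zero => exact winProb_zero _ _ _
  | succ n =>
    have hd : (pair s₁ s₂ ((coinFlipGame C p k).player h)).dist h = none := by
      rw [Option.eq_none_iff_forall_ne_some]
      intro μ hμ
      obtain ⟨⟨-, hne, -⟩, -⟩ := ((pair s₁ s₂ _).dom h).1 ⟨μ, hμ⟩
      exact hne.ne_empty he
    rw [winProb, outcomeFrom, hd]
    exact PMF.lexp_pure _ _

end recursion

theorem winProb_abort₁ (n : ℕ) : winProb s₁ s₂ n [none] = 0 := by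
  rw [winProb_of_actions_eq_empty n actions_abort₁]
  simp [coinPayoffOne]

theorem winProb_abort₂ (n : ℕ) (c : List Bool) : winProb s₁ s₂ n [some c, none] = 1 := by
  rw [winProb_of_actions_eq_empty n (actions_abort₂ c)]
  simp [coinPayoffOne]

variable {s₁ s₂}

/-- Player 1 cannot win after a guess if the commitment cannot be opened to the other bit. -/
theorem winProb_guess_eq_zero {c : List Bool} {b : Bool}
    (h : ∀ d, C.verify k c d ≠ some (!b)) : winProb s₁ s₂ 1 [some c, some [b]] = 0 := by
  cases hμ : s₁.dist [some c, some [b]] with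
  | none =>
    have hd : (pair s₁ s₂ ((coinFlipGame C p k).player [some c, some [b]])).dist
        [some c, some [b]] = none := by
      rw [player_eq, if_pos (by simp)]
      exact hμ
    rw [winProb, outcomeFrom, hd]
    refine (PMF.lexp_pure _ _).trans ?_
    simp [coinPayoffOne]
  | some μ =>
    rw [winProb_of_one 0 (by simp) hμ, ← nonpos_iff_eq_zero]
    refine (PMF.lexp_mono fun a ha => ?_).trans_eq (PMF.lexp_const _ 0)
    rcases eq_of_mem_actions_guess (s₁.legal _ _ hμ ha) with rfl | ⟨d, rfl, hd⟩
    · rw [winProb_zero]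
      simp [coinPayoffOne]
    · exact absurd hd (h d)

/-- The strategy `s` of player 1 always opens its commitments if this makes player 1 win. -/
def Opens (s : (coinFlipGame C p k).ReducedStrategy .one) : Prop :=
  ∀ c b μ, s.dist [some c, some [b]] = some μ → (∃ d, C.verify k c d = some (!b)) →
    none ∉ μ.support

theorem Opens.winProb_eq_one (hs : Opens s₁) {μ : PMF GameAction} (hμ : s₁.dist [] = some μ)
    {c : List Bool} (hc : some c ∈ μ.support) {b : Bool}
    (h : ∃ d, C.verify k c d = some (!b)) : winProb s₁ s₂ 1 [some c, some [b]] = 1 := by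
  obtain ⟨μ', hμ'⟩ := exists_dist_guess s₁ (length_le_of_commit (s₁.legal _ _ hμ hc)) b hμ hc
  rw [winProb_of_one 0 (by simp) hμ']
  refine (PMF.lexp_congr fun a ha => ?_).trans (PMF.lexp_const _ 1)
  rcases eq_of_mem_actions_guess (s₁.legal _ _ hμ' ha) with rfl | ⟨d, rfl, -⟩
  · exact absurd ha (hs c b μ' hμ' h)
  · rw [winProb_zero]
    simp [coinPayoffOne]

/-- Opening whenever possible is optimal among the strategies with the same first round, whatever
player 2 does. -/
theorem Opens.winProb_le (hs : Opens s₁) {s₁' : (coinFlipGame C p k).ReducedStrategy .one}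
    (h : s₁'.dist [] = s₁.dist []) : winProb s₁' s₂ 3 [] ≤ winProb s₁ s₂ 3 [] := by
  obtain ⟨μ, hμ⟩ := exists_dist_nil s₁
  rw [winProb_of_one 2 (by simp) hμ, winProb_of_one 2 (by simp) (h.trans hμ)]
  refine PMF.lexp_mono fun a ha => ?_
  rcases a with _ | c
  · simp [winProb_abort₁]
  obtain ⟨ν, hν⟩ := exists_dist_commit s₂ (length_le_of_commit (s₁.legal _ _ hμ ha))
  simp only [List.nil_append]
  rw [winProb_of_two 1 (by simp) hν, winProb_of_two 1 (by simp) hν]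
  refine PMF.lexp_mono fun a' ha' => ?_
  simp only [List.cons_append, List.nil_append]
  rcases eq_of_mem_actions_commit (s₂.legal _ _ hν ha') with rfl | ⟨b, rfl⟩
  · simp [winProb_abort₂]
  by_cases hd : ∃ d, C.verify k c d = some (!b)
  · rw [hs.winProb_eq_one hμ ha hd]
    exact winProb_le_one _ _ _ _
  · push Not at hd
    rw [winProb_guess_eq_zero hd]
    exact zero_le

/-- The strategy `s` of player 2 answers every commitment with a uniformly random bit. -/
def RepliesUniformly (s : (coinFlipGame C p k).ReducedStrategy .two) : Prop :=
  ∀ c μ, s.dist [some c] = some μ → μ = (PMF.uniformOfFintype Bool).map fun b => some [b]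

/-- Against a uniformly random bit player 1 wins with probability at most `1 / 2`, since a
commitment can be opened to at most one bit. -/
theorem winProb_le_half (hb : C.BindingAt k) (hs : RepliesUniformly s₂) :
    winProb s₁ s₂ 3 [] ≤ 2⁻¹ := by
  obtain ⟨μ, hμ⟩ := exists_dist_nil s₁
  rw [winProb_of_one 2 (by simp) hμ]
  refine (PMF.lexp_mono fun a ha => ?_).trans_eq (PMF.lexp_const μ _)
  rcases a with _ | c
  · simp [winProb_abort₁]
  obtain ⟨ν, hν⟩ := exists_dist_commit s₂ (length_le_of_commit (s₁.legal _ _ hμ ha))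
  obtain rfl := hs c ν hν
  simp only [List.nil_append]
  rw [winProb_of_two 1 (by simp) hν, PMF.lexp_map, PMF.lexp_uniform_bool]
  simp only [Function.comp_apply, List.cons_append, List.nil_append]
  have hle : ∀ b, 2⁻¹ * winProb s₁ s₂ 1 [some c, some [b]] ≤ 2⁻¹ := fun b =>
    mul_le_of_le_one_right zero_le (winProb_le_one _ _ _ _)
  by_cases hd : ∃ d, C.verify k c d = some false
  · obtain ⟨d, hd⟩ := hd
    rw [winProb_guess_eq_zero (b := false) fun d' hd' => hb c d d' ⟨hd, hd'⟩, mul_zero, add_zero]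
    exact hle _
  · push Not at hd
    rw [winProb_guess_eq_zero (b := true) hd, mul_zero, zero_add]
    exact hle _

/-! ### The strategies of the machines -/

theorem received_nil : (coinFlipGame C p k).received .one [] = [none] := by
  simp [received, coinFlipGame]

theorem received_commit (a : GameAction) : (coinFlipGame C p k).received .two [a] = [a] := by
  simp [received, coinFlipGame, mover]

theorem received_guess (a a' : GameAction) :
    (coinFlipGame C p k).received .one [a, a'] = [none, a'] := by
  simp [received, coinFlipGame, mover, Player.other]

theorem consistent_nil (i : Player) (M : PPTMachine) (r : M.Coins k) :
    (coinFlipGame C p k).Consistent i M k r [] := by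
  intro g a h
  simp at h

theorem consistent_commit (M : PPTMachine) (r : M.Coins k) (c : GameAction) :
    (coinFlipGame C p k).Consistent .two M k r [c] := by
  intro g a h hg
  have : g.length = 0 := by simpa using h.length_le
  rw [List.length_eq_zero_iff] at this
  subst this
  simp [player_eq] at hg

theorem repDist_of_forall_consistent {G : ExtensiveGame} {i : Player} {M : PPTMachine}
    {h : History} (hd : G.IsDecision i h) (hc : ∀ r, G.Consistent i M k r h) :
    G.repDist i M k h = some ((M.coinDist k).map fun r => G.machineAction i M k r h) := by
  have hmem : ∀ r, r ∈ G.consistentCoins i M k h := fun r => by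
    simpa [consistentCoins] using hc r
  rw [repDist, dif_pos ⟨hd, fun _ => false, hmem _⟩, PMF.uniformOfFinset_eq_uniformOfFintype _ hmem]
  rfl

theorem dist_nil_strategicRep (M : PPTMachine) :
    ((coinFlipGame C p k).strategicRep .one M k).dist [] =
      some ((M.coinDist k).map fun r => (coinFlipGame C p k).machineAction .one M k r []) :=
  repDist_of_forall_consistent isDecision_nil (consistent_nil _ M)

theorem dist_commit_strategicRep (M : PPTMachine) {c : List Bool} (hc : c.length ≤ p.eval k) :
    ((coinFlipGame C p k).strategicRep .two M k).dist [some c] =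
      some ((M.coinDist k).map fun r =>
        (coinFlipGame C p k).machineAction .two M k r [some c]) :=
  repDist_of_forall_consistent (isDecision_commit hc) fun r => consistent_commit M r _

theorem machineAction_of_mem {G : ExtensiveGame} {i : Player} {M : PPTMachine} {r : M.Coins k}
    {h : History} (hr : M.reply k [] r (G.received i h) ∈ G.actions h) :
    G.machineAction i M k r h = M.reply k [] r (G.received i h) :=
  if_pos hr

theorem machineAction_commit_eq_iff (M : PPTMachine) (r : M.Coins k) {c : List Bool}
    (hc : c.length ≤ p.eval k) (b : Bool) :
    (coinFlipGame C p k).machineAction .two M k r [some c] = some [b] ↔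
      M.reply k [] r [some c] = some [b] := by
  unfold machineAction
  rw [received_commit]
  split_ifs with h
  · rfl
  · simp only [false_iff]
    rintro h'
    rw [h'] at h
    exact h (CoinHistory.guess c b hc)

section honest

variable {M : Player → PPTMachine}

theorem repliesUniformly_of_isHonestPair (hM : IsHonestPair C M) :
    RepliesUniformly ((coinFlipGame C p k).strategicRep .two (M .two) k) := by
  intro c μ hμ
  have hH := (((coinFlipGame C p k).strategicRep .two (M .two) k).dom _).1 ⟨μ, hμ⟩
  have hc := length_le_of_commit hH.1.1
  rw [dist_commit_strategicRep _ hc, Option.some.injEq] at hμ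
  rw [← hμ, ← hM.2 k c]
  congr 1
  funext r
  have hr : (M .two).reply k [] r [some c] ∈ (((M .two).coinDist k).map fun r =>
      (M .two).reply k [] r [some c]).support :=
    (PMF.mem_support_map_iff _ _ _).2 ⟨r, by simp [PPTMachine.coinDist], rfl⟩
  rw [hM.2 k c] at hr
  obtain ⟨b, -, hb⟩ := (PMF.mem_support_map_iff _ _ _).1 hr
  rw [← hb, machineAction_commit_eq_iff _ _ hc, hb]

theorem guessProb_of_isHonestPair (hM : IsHonestPair C M) : C.guessProb (M .two) k = 1 / 2 := by
  have h : ∀ b, ∀ s : C.sender.Coins k, (((M .two).coinDist k).map fun r =>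
      decide ((M .two).reply k [] r [some (C.com k b s)] = some [b])).lexp
        (fun t => if t = true then 1 else 0) = 2⁻¹ := by
    intro b s
    have := hM.2 k (C.com k b s)
    rw [show (fun r => decide ((M .two).reply k [] r [some (C.com k b s)] = some [b])) =
      (fun a : GameAction => decide (a = some [b])) ∘
        fun r => (M .two).reply k [] r [some (C.com k b s)] from rfl,
      ← PMF.map_comp, this, PMF.lexp_map, PMF.lexp_map, PMF.lexp_uniform_bool]
    cases b <;> simp
  rw [CommitmentScheme.guessProb, ← PMF.lexp_ite_eq]
  simp only [PMF.lexp_bind, h, PMF.lexp_const]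
  simp

/-- The two messages of the honest machine of player 1, for fixed coins. -/
theorem exists_reply_of_isHonestPair (hM : IsHonestPair C M) (r : (M .one).Coins k) :
    ∃ b s, (M .one).reply k [] r [none] = some (C.com k b s) ∧
      ∀ b', (M .one).reply k [] r [none, some [b']] =
        if b ≠ b' then some (C.decom k b s) else none := by
  have hr := (PMF.mem_support_map_iff (fun r => ((M .one).reply k [] r [none],
      fun r₂ : Bool => (M .one).reply k [] r [none, some [r₂]])) ((M .one).coinDist k) _).2
      ⟨r, by simp [PPTMachine.coinDist], rfl⟩
  rw [hM.1 k] at hr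
  obtain ⟨b, -, hb⟩ := (PMF.mem_support_bind_iff _ _ _).1 hr
  obtain ⟨s, -, hs⟩ := (PMF.mem_support_map_iff _ _ _).1 hb
  rw [Prod.mk.injEq] at hs
  exact ⟨b, s, hs.1.symm, fun b' => (congrFun hs.2 b').symm⟩

theorem verify_com_decom (b : Bool) (s : C.sender.Coins k) :
    C.verify k (C.com k b s) (C.decom k b s) = some b := by
  obtain ⟨c, d, hc, hd, h⟩ := C.complete k b s fun _ => false
  simpa [CommitmentScheme.verify, CommitmentScheme.com, CommitmentScheme.decom, hc, hd] using h

theorem machineAction_nil_of_isHonestPair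
    (hp : ∀ b s, (C.com k b s).length ≤ p.eval k ∧ (C.decom k b s).length ≤ p.eval k)
    (hM : IsHonestPair C M) (r : (M .one).Coins k) :
    (coinFlipGame C p k).machineAction .one (M .one) k r [] = (M .one).reply k [] r [none] := by
  obtain ⟨b, s, h, -⟩ := exists_reply_of_isHonestPair hM r
  rw [← received_nil (C := C) (p := p) (k := k)]
  refine machineAction_of_mem ?_
  rw [received_nil, h]
  exact CoinHistory.commit _ (hp b s).1

/-- By perfect binding the honest machine of player 1 opens whenever this is possible at all. -/
theorem opens_of_isHonestPair
    (hp : ∀ b s, (C.com k b s).length ≤ p.eval k ∧ (C.decom k b s).length ≤ p.eval k)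
    (hb : C.BindingAt k) (hM : IsHonestPair C M) :
    Opens ((coinFlipGame C p k).strategicRep .one (M .one) k) := by
  rintro c b μ hμ ⟨d, hd⟩ hn
  obtain ⟨r, hr, hr'⟩ := (mem_support_of_repDist _ hμ _).1 hn
  obtain ⟨b₀, s, h₁, h₂⟩ := exists_reply_of_isHonestPair hM r
  have hc := hr [] (some c) (by simp) rfl
  rw [machineAction_nil_of_isHonestPair hp hM, h₁, Option.some.injEq] at hc
  subst hc
  have hne : b₀ ≠ b := by
    rintro rfl
    cases b₀
    · exact hb _ _ _ ⟨verify_com_decom false s, hd⟩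
    · exact hb _ _ _ ⟨hd, verify_com_decom true s⟩
  have hrep : (M .one).reply k [] r ((coinFlipGame C p k).received .one
      [some (C.com k b₀ s), some [b]]) = some (C.decom k b₀ s) := by
    rw [received_guess, h₂, if_pos hne]
  rw [machineAction_of_mem, hrep] at hr'
  · cases hr'
  · rw [hrep]
    refine CoinHistory.reveal _ _ _ (hp b₀ s).1 (hp b₀ s).2 ?_
    rw [verify_com_decom]
    cases b₀ <;> cases b <;> simp_all

/-- Against the honest machine of player 1, a machine of player 2 loses unless it guesses the
committed bit. -/
theorem one_sub_guessProb_le_payoff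
    (hp : ∀ b s, (C.com k b s).length ≤ p.eval k ∧ (C.decom k b s).length ≤ p.eval k)
    (hb : C.BindingAt k) (hM : IsHonestPair C M) (N : PPTMachine) :
    1 - C.guessProb N k ≤ payoff .one (pair ((coinFlipGame C p k).strategicRep .one (M .one) k)
      ((coinFlipGame C p k).strategicRep .two N k)) := by
  have ho := opens_of_isHonestPair (p := p) hp hb hM
  set s₁ := (coinFlipGame C p k).strategicRep .one (M .one) k with hs₁
  set s₂ := (coinFlipGame C p k).strategicRep .two N k with hs₂
  have hfirst : s₁.dist [] = some ((PMF.uniformOfFintype Bool).bind fun b =>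
      (C.sender.coinDist k).map fun s => some (C.com k b s)) := by
    have h := congrArg (PMF.map Prod.fst) (hM.1 k)
    simp only [PMF.map_bind, PMF.map_comp] at h
    rw [hs₁, dist_nil_strategicRep]
    simp only [machineAction_nil_of_isHonestPair hp hM]
    exact congrArg some h
  have key : ∀ b s, 1 ≤ winProb s₁ s₂ 2 [some (C.com k b s)] +
      ((N.coinDist k).map fun r => decide (N.reply k [] r [some (C.com k b s)] = some [b])).lexp
        fun t => if t = true then 1 else 0 := by
    intro b s
    have hmem : some (C.com k b s) ∈ ((PMF.uniformOfFintype Bool).bind fun b =>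
        (C.sender.coinDist k).map fun s => some (C.com k b s)).support := by
      refine (PMF.mem_support_bind_iff _ _ _).2 ⟨b, by simp, ?_⟩
      exact (PMF.mem_support_map_iff _ _ _).2 ⟨s, by simp [PPTMachine.coinDist], rfl⟩
    have hν := dist_commit_strategicRep (C := C) (p := p) N (hp b s).1
    rw [winProb_of_two 1 (by simp) hν, PMF.lexp_map, PMF.lexp_map, ← PMF.lexp_add]
    refine (PMF.lexp_const (N.coinDist k) 1).symm.trans_le (PMF.lexp_mono fun r _ => ?_)
    simp only [Function.comp_apply, List.cons_append, List.nil_append, decide_eq_true_eq]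
    have hr : (coinFlipGame C p k).machineAction .two N k r [some (C.com k b s)] ∈
        (coinFlipGame C p k).actions [some (C.com k b s)] := by
      refine s₂.legal _ _ hν ((PMF.mem_support_map_iff _ _ _).2 ⟨r, ?_, rfl⟩)
      simp [PPTMachine.coinDist]
    rcases eq_of_mem_actions_commit hr with ha | ⟨b', ha⟩
    · rw [ha, winProb_abort₂]
      exact le_self_add
    · rw [ha]
      by_cases hbb : b' = b
      · rw [if_pos ((machineAction_commit_eq_iff N r (hp b s).1 b).1 (hbb ▸ ha))]
        exact le_add_self
      · rw [ho.winProb_eq_one hfirst hmem ⟨C.decom k b s, ?_⟩]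
        · exact le_self_add
        · rw [verify_com_decom]
          cases b <;> cases b' <;> simp_all
  have htotal : 1 ≤ winProb s₁ s₂ 3 [] + ((PMF.uniformOfFintype Bool).bind fun b =>
      (C.sender.coinDist k).bind fun s => (N.coinDist k).map fun r =>
        decide (N.reply k [] r [some (C.com k b s)] = some [b])) true := by
    rw [winProb_of_one 2 (by simp) hfirst, ← PMF.lexp_ite_eq]
    simp only [PMF.lexp_bind, PMF.lexp_map _ (fun s => some (C.com k _ s)), ← PMF.lexp_add]
    refine (PMF.lexp_const (PMF.uniformOfFintype Bool) 1).symm.trans_le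
      (PMF.lexp_mono fun b _ => ?_)
    exact (PMF.lexp_const (C.sender.coinDist k) 1).symm.trans_le (PMF.lexp_mono fun s _ => key b s)
  have h := ENNReal.toReal_mono (ENNReal.add_ne_top.2
    ⟨winProb_ne_top _ _ _ _, PMF.apply_ne_top _ _⟩) htotal
  rw [ENNReal.toReal_add (winProb_ne_top _ _ _ _) (PMF.apply_ne_top _ _), ENNReal.toReal_one] at h
  rw [payoff_one_eq, sub_le_iff_le_add]
  exact h

end honest

theorem payoff_one_le_half (hb : C.BindingAt k) (hs : RepliesUniformly s₂) :
    payoff .one (pair s₁ s₂) ≤ 1 / 2 := by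
  rw [payoff_one_eq]
  have h := ENNReal.toReal_mono (by simp) (winProb_le_half (s₁ := s₁) hb hs)
  rwa [ENNReal.toReal_inv, ENNReal.toReal_ofNat, ← one_div] at h

theorem Opens.payoff_one_le (hs : Opens s₁) {s₁' : (coinFlipGame C p k).ReducedStrategy .one}
    (h : s₁'.dist [] = s₁.dist []) : payoff .one (pair s₁' s₂) ≤ payoff .one (pair s₁ s₂) := by
  rw [payoff_one_eq, payoff_one_eq]
  exact ENNReal.toReal_mono (winProb_ne_top _ _ _ _) (hs.winProb_le h)

theorem payoff_one_nonneg (σ : (coinFlipGame C p k).Profile) : 0 ≤ payoff .one σ := by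
  rw [payoff_one_eq]
  exact ENNReal.toReal_nonneg

theorem payoff_one_le_one (σ : (coinFlipGame C p k).Profile) : payoff .one σ ≤ 1 := by
  rw [payoff_one_eq]
  simpa using ENNReal.toReal_mono (by simp) (winProb_le_one (σ .one) (σ .two) 3 [])

end CoinFlip

/-! ### Threats in the coin-flipping game -/

namespace CoinFlip

open ExtensiveGame

variable {C : CommitmentScheme} {p : Polynomial ℕ} {k : ℕ}

theorem exists_forall_le_add {α : Type*} {s : Set α} (hs : s.Nonempty) (f : α → ℝ) {B : ℝ}
    (hB : ∀ a ∈ s, f a ≤ B) {δ : ℝ} (hδ : 0 < δ) : ∃ a ∈ s, ∀ b ∈ s, f b ≤ f a + δ := by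
  obtain ⟨_, ⟨a, ha, rfl⟩, h⟩ := exists_lt_of_lt_csSup (hs.image f) (sub_lt_self (sSup (f '' s)) hδ)
  refine ⟨a, ha, fun b hb => ?_⟩
  have := le_csSup ⟨B, by rintro _ ⟨a, ha, rfl⟩; exact hB a ha⟩ (Set.mem_image_of_mem f hb)
  linarith

theorem round_zero {i : Player} (s : (coinFlipGame C p k).ReducedStrategy i) :
    s.round 0 = fun _ => none := by
  funext h
  simp [ReducedStrategy.round]

theorem dist_two_eq_none (s : (coinFlipGame C p k).ReducedStrategy .two) {h : History}
    (hh : h.length ≠ 1) : s.dist h = none := by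
  rw [Option.eq_none_iff_forall_ne_some]
  intro μ hμ
  obtain ⟨c, rfl⟩ := eq_commit_of_isDecision ((s.dom h).1 ⟨μ, hμ⟩).1
  exact hh rfl

theorem round_one_two (s : (coinFlipGame C p k).ReducedStrategy .two) :
    s.round 1 = fun _ => none := by
  funext h
  unfold ReducedStrategy.round
  split_ifs with hh
  · exact dist_two_eq_none s (by omega)
  · rfl

/-- Player 2 moves in the second round only. -/
theorem eq_of_round_two_eq {s s' : (coinFlipGame C p k).ReducedStrategy .two}
    (h : s.round 2 = s'.round 2) : s = s' := by
  have hd : s.dist = s'.dist := by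
    funext g
    by_cases hg : g.length = 1
    · simpa [ReducedStrategy.round, hg] using congrFun h g
    · rw [dist_two_eq_none s hg, dist_two_eq_none s' hg]
  cases s
  cases s'
  cases hd
  rfl

theorem dist_nil_eq_of_round_one_eq {s s' : (coinFlipGame C p k).ReducedStrategy .one}
    (h : s.round 1 = s'.round 1) : s.dist [] = s'.dist [] := by
  simpa [ReducedStrategy.round] using congrFun h []

theorem sameRound_of_lt_two {σ π : (coinFlipGame C p k).Profile}
    (h : (σ .one).round 1 = (π .one).round 1) {S : ℕ} (hS : S < 2) : SameRound σ π S := by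
  intro i
  obtain rfl | rfl : S = 0 ∨ S = 1 := by omega
  · rw [round_zero, round_zero]
  · cases i
    · exact h
    · rw [round_one_two, round_one_two]

variable {T : ∀ i, Set ((coinFlipGame C p k).ReducedStrategy i)} {ε : ℝ}
  {σ : (coinFlipGame C p k).Profile}

theorem allowed_pair {s₁ : (coinFlipGame C p k).ReducedStrategy .one}
    {s₂ : (coinFlipGame C p k).ReducedStrategy .two} (h₁ : s₁ ∈ T .one) (h₂ : s₂ ∈ T .two) :
    pair s₁ s₂ ∈ Allowed T
  | .one => h₁
  | .two => h₂

theorem mem_cont_self (hσ : σ ∈ Allowed T) (R : ℕ) : σ ∈ cont T σ R :=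
  ⟨hσ, fun _ _ _ => rfl⟩

/-- No threat is faced in the last round if player 1 cannot gain more than `ε` by changing only the
third round of the strategy. -/
theorem not_facesThreat_three (hσ : σ ∈ Allowed T)
    (h : ∀ s ∈ T .one, s.round 1 = (σ .one).round 1 →
      payoff .one (pair s (σ .two)) ≤ payoff .one σ + ε) :
    ¬ FacesThreat T ε 3 σ := by
  rw [FacesThreat]
  rintro ⟨τ, -, ⟨ρ, hρ⟩, hgt⟩
  have hlast : ∀ π : (coinFlipGame C p k).Profile, ∀ S, 3 < S → S ≤ (coinFlipGame C p k).rounds →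
      ¬ FacesThreat T ε S π := fun π S h₁ h₂ => absurd h₂ (not_le.2 h₁)
  have hlt : payoff .one ρ > payoff .one σ + ε :=
    hgt ρ hρ σ (mem_cont_self hσ 3) (hlast ρ) (hlast σ)
  obtain ⟨hρT, hρS, -⟩ := hρ
  have h₂ : ρ .two = σ .two := eq_of_round_two_eq (hρS 2 (by norm_num) .two)
  have := h (ρ .one) (hρT .one) (hρS 1 (by norm_num) .one)
  rw [← h₂, pair_eta] at this
  exact hlt.not_ge this

/-- A profile without a threat in the third round has none in the second round either, if every
strategy of player 2 has a threat-free continuation by which player 2 gains at most `ε`. -/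
theorem not_facesThreat_two (hσ : σ ∈ Allowed T) (h₃ : ¬ FacesThreat T ε 3 σ)
    (h : ∀ s₂ ∈ T .two, ∃ s₁ ∈ T .one, s₁.round 1 = (σ .one).round 1 ∧
      ¬ FacesThreat T ε 3 (pair s₁ s₂) ∧ payoff .one σ ≤ payoff .one (pair s₁ s₂) + ε) :
    ¬ FacesThreat T ε 2 σ := by
  rw [FacesThreat]
  rintro ⟨τ, -, ⟨ρ, hρ⟩, hgt⟩
  obtain ⟨s₁, hs₁, hr, hf, hle⟩ := h (ρ .two) (hρ.1 .two)
  have hmem : pair s₁ (ρ .two) ∈ contWith T σ 2 τ :=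
    ⟨allowed_pair hs₁ (hρ.1 .two), fun S hS => sameRound_of_lt_two hr hS, hρ.2.2⟩
  have hthree : ∀ π : (coinFlipGame C p k).Profile, ¬ FacesThreat T ε 3 π →
      ∀ S, 2 < S → S ≤ (coinFlipGame C p k).rounds → ¬ FacesThreat T ε S π := by
    intro π hπ S h₁ h₂
    obtain rfl : S = 3 := le_antisymm h₂ h₁
    exact hπ
  have hlt : payoff .two (pair s₁ (ρ .two)) > payoff .two σ + ε :=
    hgt _ hmem σ (mem_cont_self hσ 2) (hthree _ hf) (hthree _ h₃)
  rw [payoff_two_eq, payoff_two_eq] at hlt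
  linarith

/-- A profile without later threats has none in the first round either, if player 1 cannot gain by
any deviation from it: after a deviation of player 1 in the first round, the almost optimal reply
of player 2 is worth at most `ε` more to player 1 than the reply prescribed by the profile. -/
theorem not_facesThreat_one (hε : 0 < ε) (hσ : σ ∈ Allowed T) (h₂ : ¬ FacesThreat T ε 2 σ)
    (h₃ : ¬ FacesThreat T ε 3 σ)
    (h : ∀ s ∈ T .one, payoff .one (pair s (σ .two)) ≤ payoff .one σ) :
    ¬ FacesThreat T ε 1 σ := by
  rw [FacesThreat]
  rintro ⟨τ, -, ⟨ρ, hρ⟩, hgt⟩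
  -- the strategies of player 1 that start with `τ`
  set A : Set ((coinFlipGame C p k).ReducedStrategy .one) := {s | s ∈ T .one ∧ s.round 1 = τ}
  have hAne : A.Nonempty := ⟨ρ .one, hρ.1 .one, hρ.2.2⟩
  -- `b s₂` is an almost optimal continuation of `τ` against `s₂`; the `s₂` obtained below almost
  -- minimizes its value
  choose b hbA hb using fun s₂ : (coinFlipGame C p k).ReducedStrategy .two =>
    exists_forall_le_add hAne (fun s₁ => payoff .one (pair s₁ s₂))
      (fun s₁ _ => payoff_one_le_one (pair s₁ s₂)) hε
  obtain ⟨s₂, hs₂, hmin⟩ := exists_forall_le_add ⟨σ .two, hσ .two⟩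
    (fun s₂ => - payoff .one (pair (b s₂) s₂)) (B := 0)
    (fun s₂ _ => neg_nonpos.2 (payoff_one_nonneg _)) hε
  have hall : ∀ s ∈ T .two, pair (b s) s ∈ Allowed T := fun s hs => allowed_pair (hbA s).1 hs
  have hfree : ∀ s ∈ T .two, ¬ FacesThreat T ε 3 (pair (b s) s) := fun s hs =>
    not_facesThreat_three (hall s hs) fun s₁ hs₁ hr => hb s s₁ ⟨hs₁, hr.trans (hbA s).2⟩
  have hfree₂ : ¬ FacesThreat T ε 2 (pair (b s₂) s₂) :=
    not_facesThreat_two (hall s₂ hs₂) (hfree s₂ hs₂) fun s hs =>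
      ⟨b s, (hbA s).1, (hbA s).2.trans (hbA s₂).2.symm, hfree s hs, by linarith [hmin s hs]⟩
  have hmem : pair (b s₂) s₂ ∈ contWith T σ 1 τ := by
    refine ⟨hall s₂ hs₂, fun S hS i => ?_, (hbA s₂).2⟩
    obtain rfl : S = 0 := by omega
    rw [round_zero, round_zero]
  have hlater : ∀ π : (coinFlipGame C p k).Profile, ¬ FacesThreat T ε 2 π →
      ¬ FacesThreat T ε 3 π → ∀ S, 1 < S → S ≤ (coinFlipGame C p k).rounds →
      ¬ FacesThreat T ε S π := by
    intro π hπ₂ hπ₃ S h₁ h₂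
    have h₂' : S ≤ 3 := h₂
    obtain rfl | rfl : S = 2 ∨ S = 3 := by omega
    · exact hπ₂
    · exact hπ₃
  have hlt : payoff .one (pair (b s₂) s₂) > payoff .one σ + ε :=
    hgt _ hmem σ (mem_cont_self hσ 1) (hlater _ hfree₂ (hfree s₂ hs₂)) (hlater _ h₂ h₃)
  have h₄ := hmin (σ .two) (hσ .two)
  have h₅ := h (b (σ .two)) (hbA _).1
  linarith

/-- Suppose that player 1 always opens, that player 2 replies uniformly, and that no allowed
strategy of player 2 pushes the payoff of player 1 below `1 / 2 - ε`.  Then the profile is an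
`ε`-threat-free Nash equilibrium. -/
theorem isTFNE_of_opens (hb : C.BindingAt k) (hε : 0 < ε) (hσ : σ ∈ Allowed T)
    (ho : Opens (σ .one)) (hu : RepliesUniformly (σ .two)) (hhalf : 1 / 2 ≤ payoff .one σ)
    (hT : ∀ s₂ ∈ T .two, 1 / 2 - ε ≤ payoff .one (pair (σ .one) s₂)) :
    IsTFNE T ε σ := by
  have hle : ∀ s₁, payoff .one (pair s₁ (σ .two)) ≤ 1 / 2 := fun s₁ => payoff_one_le_half hb hu
  have heq : payoff .one σ = 1 / 2 := le_antisymm (by simpa [pair_eta] using hle (σ .one)) hhalf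
  have hfree : ∀ s₂ ∈ T .two, ¬ FacesThreat T ε 3 (pair (σ .one) s₂) := fun s₂ hs₂ =>
    not_facesThreat_three (allowed_pair (hσ .one) hs₂) fun s _ hr =>
      (ho.payoff_one_le (dist_nil_eq_of_round_one_eq hr)).trans (le_add_of_nonneg_right hε.le)
  have h₃ : ¬ FacesThreat T ε 3 σ := by simpa only [pair_eta] using hfree (σ .two) (hσ .two)
  have h₂ : ¬ FacesThreat T ε 2 σ := not_facesThreat_two hσ h₃ fun s₂ hs₂ =>
    ⟨σ .one, hσ .one, rfl, hfree s₂ hs₂, by linarith [hT s₂ hs₂]⟩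
  have h₁ : ¬ FacesThreat T ε 1 σ := not_facesThreat_one hε hσ h₂ h₃ fun s _ => by
    rw [heq]
    exact hle s
  refine ⟨⟨hσ, fun i s hs => ?_⟩, fun R hR hR' => ?_⟩
  · cases i with
    | one =>
      have : Function.update σ .one s = pair s (σ .two) := by
        funext i
        cases i <;> simp [pair]
      rw [this]
      linarith [hle s]
    | two =>
      have : Function.update σ .two s = pair (σ .one) s := by
        funext i
        cases i <;> simp [pair]
      rw [this, payoff_two_eq, payoff_two_eq]
      linarith [hT s hs]
  · have hR'' : R ≤ 3 := hR'
    obtain rfl | rfl | rfl : R = 1 ∨ R = 2 ∨ R = 3 := by omega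
    exacts [h₁, h₂, h₃]

end CoinFlip

/-! ### The filters -/

namespace StrategyFilter

variable {Γ : ComputationalGame} {i : Player} {acc : ℕ → PPTMachine → unitInterval → Prop}

theorem ofPred_eq_some_iff {k : ℕ} {M : PPTMachine} {ε : unitInterval}
    {s : (Γ k).ReducedStrategy i} :
    (ofPred Γ i acc).toFun k M ε = some s ↔ acc k M ε ∧ (Γ k).strategicRep i M k = s := by
  by_cases h : acc k M ε <;> simp [ofPred, h]

theorem ofPred_ne_none_iff {k : ℕ} {M : PPTMachine} {ε : unitInterval} :
    (ofPred Γ i acc).toFun k M ε ≠ none ↔ acc k M ε := by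
  by_cases h : acc k M ε <;> simp [ofPred, h]

end StrategyFilter

namespace CommitmentScheme

variable (C : CommitmentScheme)

/-- A machine that guesses the committed bit is itself a distinguisher, with at least
the same advantage. -/
theorem guessProb_le (M : PPTMachine) (k : ℕ) :
    C.guessProb M k ≤ 1 / 2 + |C.acceptProb M k false - C.acceptProb M k true| := by
  set A : Bool → ℝ≥0∞ := fun b => ((C.sender.coinDist k).bind fun s => (M.coinDist k).map fun r =>
    asBit (M.reply k [] r [some (C.com k b s)])) (some true) with hA
  set B : Bool → ℝ≥0∞ := fun b => (C.sender.coinDist k).lexp fun s => (M.coinDist k).lexp fun r =>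
    if M.reply k [] r [some (C.com k b s)] = some [b] then 1 else 0 with hB
  have hasBit : ∀ a : GameAction, asBit a = some true ↔ a = some [true] := by
    intro a
    unfold asBit
    split <;> simp_all
  have hAB : ∀ b, A b = (C.sender.coinDist k).lexp fun s => (M.coinDist k).lexp fun r =>
      if M.reply k [] r [some (C.com k b s)] = some [true] then 1 else 0 := by
    intro b
    simp only [hA]
    rw [← PMF.lexp_ite_eq, PMF.lexp_bind]
    simp only [PMF.lexp_map, Function.comp_def, hasBit]
  have hguess : C.guessProb M k = (2⁻¹ * B true + 2⁻¹ * B false).toReal := by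
    rw [guessProb, ← PMF.lexp_ite_eq, PMF.lexp_bind, PMF.lexp_uniform_bool]
    simp only [PMF.lexp_bind, PMF.lexp_map, Function.comp_def, decide_eq_true_eq, hB]
  have htrue : B true = A true := (hAB true).symm
  have hfalse : B false + A false ≤ 1 := by
    rw [hAB, hB, ← PMF.lexp_add]
    refine (PMF.lexp_mono fun s _ => ?_).trans_eq (PMF.lexp_const (C.sender.coinDist k) 1)
    rw [← PMF.lexp_add]
    refine (PMF.lexp_mono fun r _ => ?_).trans_eq (PMF.lexp_const (M.coinDist k) 1)
    by_cases h : M.reply k [] r [some (C.com k false s)] = some [false]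
    · simp [h]
    · rw [if_neg h, zero_add]
      split_ifs <;> simp
  have hAtop : ∀ b, A b ≠ ⊤ := fun b => PMF.apply_ne_top _ _
  have hBtop : B false ≠ ⊤ := ne_top_of_le_ne_top ENNReal.one_ne_top (le_self_add.trans hfalse)
  have h₁ := ENNReal.toReal_mono ENNReal.one_ne_top hfalse
  rw [ENNReal.toReal_add hBtop (hAtop _), ENNReal.toReal_one] at h₁
  rw [hguess, htrue, ENNReal.toReal_add (ENNReal.mul_ne_top (by simp) (hAtop _))
    (ENNReal.mul_ne_top (by simp) hBtop), ENNReal.toReal_mul,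
    ENNReal.toReal_mul, ENNReal.toReal_inv, ENNReal.toReal_ofNat]
  have h₂ := neg_abs_le (C.acceptProb M k false - C.acceptProb M k true)
  have h₃ := abs_nonneg (C.acceptProb M k false - C.acceptProb M k true)
  have h₄ : ∀ b, C.acceptProb M k b = (A b).toReal := fun _ => rfl
  rw [h₄, h₄] at h₂ h₃ ⊢
  linarith

/-- Hiding commitments cannot be guessed with an advantage that is not negligible. -/
theorem ComputationallyHiding.eventually_guessProb_le {C : CommitmentScheme}
    (h : C.ComputationallyHiding) (M : PPTMachine) (q : Polynomial ℝ)
    (hq : ∀ n : ℕ, 0 < q.eval (n : ℝ)) :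
    ∀ᶠ k : ℕ in atTop, C.guessProb M k ≤ 1 / 2 + 1 / q.eval (k : ℝ) :=
  (h M q hq).mono fun k hk => (C.guessProb_le M k).trans (by gcongr)

end CommitmentScheme

/-- The filter of player 1 looks at the security parameter `k` only.  It accepts where `P k` holds,
which has to be the case for all large `k`, and only where commitments are binding. -/
theorem witnessCTFNE_of_binding {C : CommitmentScheme} (hhiding : C.ComputationallyHiding)
    {p : Polynomial ℕ} (hp : ∀ (k : ℕ) (b : Bool) (s : C.sender.Coins k),
      (C.com k b s).length ≤ p.eval k ∧ (C.decom k b s).length ≤ p.eval k)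
    {M : Player → PPTMachine} (hM : IsHonestPair C M)
    {F : ∀ i, StrategyFilter (coinFlipGame C p) i} (hF : F .two = coinFilters C p .two)
    {P : ℕ → Prop} (hF₁ : F .one = .ofPred _ .one fun k _ _ => P k) (hP : ∀ᶠ k in atTop, P k)
    (hb : ∀ k, P k → C.BindingAt k) :
    WitnessCTFNE (coinFlipGame C p) M F := by
  have hF₂ : F .two =
      .ofPred _ .two fun k M ε => 0 < (ε : ℝ) ∧ C.guessProb M k ≤ 1 / 2 + (ε : ℝ) := hF
  refine ⟨fun i N q hq => ?_, fun k ε σ hσ => ?_⟩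
  · cases i with
    | one =>
      obtain ⟨k₀, h⟩ := eventually_atTop.1 hP
      refine ⟨k₀, fun k hk ε _ => ?_⟩
      rw [hF₁, StrategyFilter.ofPred_ne_none_iff]
      exact h k hk
    | two =>
      obtain ⟨k₀, h⟩ := eventually_atTop.1 (hhiding.eventually_guessProb_le N q hq)
      refine ⟨k₀, fun k hk ε hε => ?_⟩
      rw [hF₂, StrategyFilter.ofPred_ne_none_iff, hε]
      exact ⟨one_div_pos.2 (hq k), h k hk⟩
  · have h₁ := hσ .one
    have h₂ := hσ .two
    rw [hF₁, StrategyFilter.ofPred_eq_some_iff] at h₁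
    rw [hF₂, StrategyFilter.ofPred_eq_some_iff] at h₂
    obtain ⟨hPk, h₁⟩ := h₁
    obtain ⟨⟨hε, -⟩, h₂⟩ := h₂
    have hbk := hb k hPk
    have hσ' : CoinFlip.pair (σ .one) (σ .two) = σ := CoinFlip.pair_eta σ
    refine CoinFlip.isTFNE_of_opens hbk hε (fun i => ⟨M i, hσ i⟩) ?_ ?_ ?_ ?_
    · rw [← h₁]
      exact CoinFlip.opens_of_isHonestPair (hp k) hbk hM
    · rw [← h₂]
      exact CoinFlip.repliesUniformly_of_isHonestPair hM
    · have h := CoinFlip.one_sub_guessProb_le_payoff (hp k) hbk hM (M .two)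
      rw [h₁, h₂, hσ', CoinFlip.guessProb_of_isHonestPair hM] at h
      linarith
    · rintro s₂ ⟨N, hN⟩
      rw [hF₂, StrategyFilter.ofPred_eq_some_iff] at hN
      obtain ⟨⟨-, hguess⟩, rfl⟩ := hN
      have h := CoinFlip.one_sub_guessProb_le_payoff (hp k) hbk hM N
      rw [h₁] at h
      linarith

theorem mainTheorem3 (C : CommitmentScheme) (hhiding : C.ComputationallyHiding)
    (hbinding : ∀ᶠ k : ℕ in Filter.atTop, C.BindingAt k) (p : Polynomial ℕ)
    (hp : ∀ (k : ℕ) (b : Bool) (s : C.sender.Coins k),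
      (C.com k b s).length ≤ p.eval k ∧ (C.decom k b s).length ≤ p.eval k) :
    (∃ M : Player → PPTMachine, IsHonestPair C M) ∧
    ∀ M : Player → PPTMachine, IsHonestPair C M →
      IsCTFNE (coinFlipGame C p) M ∧
      ((∀ k : ℕ, C.BindingAt k) → WitnessCTFNE (coinFlipGame C p) M (coinFilters C p)) := by
  refine ⟨exists_isHonestPair C, fun M hM => ⟨?_, fun hb => ?_⟩⟩
  · -- the filter of player 1 rejects everything where commitments are not binding
    exact ⟨fun
        | .one => .ofPred _ .one fun k _ _ => C.BindingAt k
        | .two => coinFilters C p .two,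
      witnessCTFNE_of_binding hhiding hp hM rfl rfl hbinding fun _ h => h⟩
  · exact witnessCTFNE_of_binding hhiding hp hM rfl rfl (P := fun _ => True)
      (Eventually.of_forall fun _ => trivial) fun k _ => hb k
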